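/- Let $p,q\ge 0$. Let $\mathbb R^{p,q}$ be $\mathbb R^{p+q}$ with its standard metric of signature $(p,q)$, let $\mathrm O(p,q)$ be its group of linear isometries, with Lie algebra $\mathfrak o(p,q)$, and let $\mathrm{IO}(p,q)=\mathrm O(p,q)\ltimes\mathbb R^{p,q}$ be the Poincaré group, with Lie algebra $\mathfrak{io}(p,q)=\mathfrak o(p,q)\oplus\mathbb R^{p,q}$. For a Lie 2-group with crossed module $(G,H,t,\alpha)$ and infinitesimal crossed module $(\mathfrak g,\mathfrak h,\underline t,\underline\alpha)$, a *2-connection* on the trivial principal 2-bundle over a smooth manifold $M$ is a pair $(A,B)$ of a smooth $\mathfrak g$-valued 1-form $A$ and a smooth $\mathfrak h$-valued 2-form $B$ on $M$ with $dA+A\wedge A=\underline t(B)$. The data of a *weak gauge transformation* are a smooth map $g\colon M\to G$ and a smooth $\mathfrak h$-valued 1-form $a$. If $H$ is abelian, it takes $(A,B)$ to $$A'=gAg^{-1}+g\,dg^{-1}+\underline t(a),\qquad B'=\alpha(g)(B)+d_{A'}a,\qquad d_{A'}a=da+\underline\alpha(A')\wedge a .$$ The teleparallel 2-group $\mathbf{Tel}(p,q)$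 has the crossed module $G=\mathrm{IO}(p,q)$, $H=\mathbb R^{p,q}$, $t(v)=(1,v)$, $\alpha(h,v)w=hw$. The Poincaré 2-group $\mathbf{Poinc}(p,q)$ has the crossed module $G=\mathrm O(p,q)$, $H=\mathbb R^{p,q}$, $t$ trivial, $\alpha(h)w=hw$. The 1-form of a $\mathbf{Tel}(p,q)$ 2-connection is written $A=(\omega,e)$, with $\omega$ valued in $\mathfrak o(p,q)$ and $e$ valued in $\mathbb R^{p,q}$. The data of a weak $\mathbf{Poinc}(p,q)$ gauge transformation, a smooth map $h\colon M\to\mathrm O(p,q)$ and a smooth $\mathbb R^{p,q}$-valued 1-form $a$, act on $\mathbf{Tel}(p,q)$ 2-connections as the weak $\mathbf{Tel}(p,q)$ gauge transformation with $g=(h,0)$ (translation part $v=0$) and the same $a$. **Theorem.** Let $M$ be a smooth manifold with $\pi_1(M)=0$ (that is, $\pi_1(M,x)$ is trivial for every $x\in M$). Then all 2-connections on the trivial $\mathbf{Tel}(p,q)$ 2-bundle over $M$ are equivalent under weak $\mathbf{Poinc}(p,q)$ gauge transformations: for any two such 2-connections $((\omega,e),B)$ and $((\omega',e'),B')$ there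 are a smooth map $h\colon M\to\mathrm O(p,q)$ and a smooth $\mathbb R^{p,q}$-valued 1-form $a$ on $M$ such that the weak gauge transformation given by $(h,a)$ takes the first to the second. Explicitly, $$\omega'=h\omega h^{-1}+h\,dh^{-1},\qquad e'=he+a,\qquad B'=hB+d_{\omega'}a .$$ -/

import Mathlib

open scoped Manifold ContDiff

noncomputable section

namespace HigherGauge

/-! ### Differential forms of degree one and two with values in a normed space

`M` is a smooth manifold without boundary, modelled on the finite-dimensional space `E`. -/

section Forms

variable (E : Type*) [NormedAddCommGroup E] [NormedSpace ℝ E]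
  (M : Type*) [TopologicalSpace M] [ChartedSpace E M]
  (F : Type*) [NormedAddCommGroup F] [NormedSpace ℝ F]

/-- A field of `F`-valued linear forms on the tangent spaces of `M`. -/
abbrev PreOneForm := (x : M) → TangentSpace 𝓘(ℝ, E) x →L[ℝ] F

/-- A field of `F`-valued bilinear forms on the tangent spaces of `M`. -/
abbrev PreTwoForm :=
  (x : M) → TangentSpace 𝓘(ℝ, E) x →L[ℝ] TangentSpace 𝓘(ℝ, E) x →L[ℝ] F

variable {E M F}

/-- The coordinate expression `(φ⁻¹)^* A` of `A` in the chart `φ`; it is meaningful on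
`φ.target`. -/
def localOne (φ : OpenPartialHomeomorph M E) (A : PreOneForm E M F) (y : E) : E →L[ℝ] F :=
  (A (φ.symm y)).comp (mfderiv 𝓘(ℝ, E) 𝓘(ℝ, E) φ.symm y)

/-- The coordinate expression `(φ⁻¹)^* B` of `B` in the chart `φ`; it is meaningful on
`φ.target`. -/
def localTwo (φ : OpenPartialHomeomorph M E) (B : PreTwoForm E M F) (y : E) :
    E →L[ℝ] E →L[ℝ] F :=
  let b : E →L[ℝ] E →L[ℝ] F := B (φ.symm y)
  let D : E →L[ℝ] E := mfderiv 𝓘(ℝ, E) 𝓘(ℝ, E) φ.symm y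
  b.bilinearComp D D

variable (E M F)

/-- Smooth `F`-valued 1-forms on `M`. -/
structure OneForm where
  toFun : PreOneForm E M F
  smooth : ∀ φ ∈ atlas E M, ContDiffOn ℝ ∞ (localOne φ toFun) φ.target

/-- Smooth `F`-valued 2-forms on `M`. -/
structure TwoForm where
  toFun : PreTwoForm E M F
  alternating : ∀ x v, toFun x v v = 0
  smooth : ∀ φ ∈ atlas E M, ContDiffOn ℝ ∞ (localTwo φ toFun) φ.target

variable {E M F}

/-- The exterior derivative of a 1-form: in coordinates `(dA)ᵢⱼ = ∂ᵢ Aⱼ - ∂ⱼ Aᵢ`, computed at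
`x` in the chart chosen at `x`. -/
def extDer (A : OneForm E M F) (x : M) (v w : TangentSpace 𝓘(ℝ, E) x) : F :=
  let φ := chartAt E x
  let dφ : TangentSpace 𝓘(ℝ, E) x →L[ℝ] E := mfderiv 𝓘(ℝ, E) 𝓘(ℝ, E) φ x
  fderiv ℝ (localOne φ A.toFun) (φ x) (dφ v) (dφ w)
    - fderiv ℝ (localOne φ A.toFun) (φ x) (dφ w) (dφ v)

end Forms

/-! ### Lie crossed modules -/

/-- A Lie crossed module `(G, H, t, α)` together with its infinitesimal crossed module
`(𝔤, 𝔥, dt, dα)`, in the case where `G` is a linear Lie group (a closed subgroup of the unit group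
of the algebra `𝒜`) and `H` is the additive group of a vector space `V`, so that `𝔥 = V`
is an abelian Lie algebra.  The infinitesimal data are the derivatives of the global data. -/
structure LieCrossedModule (𝒜 : Type*) [NormedRing 𝒜] [NormedAlgebra ℝ 𝒜]
    (V : Type*) [NormedAddCommGroup V] [NormedSpace ℝ V] where
  /-- the Lie group of objects -/
  G : Subgroup 𝒜ˣ
  isClosed : IsClosed (G : Set 𝒜ˣ)
  /-- the target homomorphism `H → G` -/
  t : Multiplicative V →* G
  continuous_t : Continuous t
  /-- the action of `G` on `H` by automorphisms -/
  α : G →* (V →L[ℝ] V)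
  continuous_α : Continuous α
  equivariance : ∀ (g : G) (v : V),
    t (Multiplicative.ofAdd (α g v)) = g * t (Multiplicative.ofAdd v) * g⁻¹
  peiffer : ∀ v w : V, α (t (Multiplicative.ofAdd v)) w = v + w - v
  /-- the Lie algebra of `G` -/
  𝔤 : Submodule ℝ 𝒜
  mem_𝔤 : ∀ X : 𝒜, X ∈ 𝔤 ↔ ∀ s : ℝ, ∃ g ∈ G, (g : 𝒜) = NormedSpace.exp (s • X)
  lie_mem_𝔤 : ∀ X ∈ 𝔤, ∀ Y ∈ 𝔤, X * Y - Y * X ∈ 𝔤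
  /-- the derivative of `t` -/
  dt : V →ₗ[ℝ] 𝔤
  hasDeriv_t : ∀ v : V,
    HasDerivAt (fun s : ℝ => ((t (Multiplicative.ofAdd (s • v)) : 𝒜ˣ) : 𝒜)) (dt v : 𝒜) 0
  /-- the derivative of `α` -/
  dα : 𝔤 →ₗ[ℝ] (V →L[ℝ] V)
  hasDeriv_α : ∀ (X : 𝔤) (γ : ℝ → G),
    (∀ s, ((γ s : 𝒜ˣ) : 𝒜) = NormedSpace.exp (s • (X : 𝒜))) →
      HasDerivAt (fun s => α (γ s)) (dα X) 0

section Gauge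

variable (E : Type*) [NormedAddCommGroup E] [NormedSpace ℝ E]
  (M : Type*) [TopologicalSpace M] [ChartedSpace E M]
  {𝒜 : Type*} [NormedRing 𝒜] [NormedAlgebra ℝ 𝒜]
  {V : Type*} [NormedAddCommGroup V] [NormedSpace ℝ V]

/-- A 2-connection on the trivial principal 2-bundle over `M` whose structure 2-group has the
crossed module `𝒢`: a `𝔤`-valued 1-form `A` and an `𝔥`-valued 2-form `B` with
`dA + A ∧ A = dt(B)`.  Here `A ∧ A = ½ [A, A]`, that is,
`(A ∧ A)(v, w) = [A v, A w]`. -/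
structure TwoConnection (𝒢 : LieCrossedModule 𝒜 V) where
  A : OneForm E M 𝒜
  A_mem : ∀ x v, A.toFun x v ∈ 𝒢.𝔤
  B : TwoForm E M V
  fakeFlat : ∀ (x : M) (v w : TangentSpace 𝓘(ℝ, E) x),
    extDer A x v w + (A.toFun x v * A.toFun x w - A.toFun x w * A.toFun x v) = (𝒢.dt (B.toFun x v w) : 𝒜)

/-- The value of the 1-form of a 2-connection, as an element of the Lie algebra `𝔤`. -/
def TwoConnection.value {E : Type*} [NormedAddCommGroup E] [NormedSpace ℝ E]
    {M : Type*} [TopologicalSpace M] [ChartedSpace E M] {𝒢 : LieCrossedModule 𝒜 V}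
    (c : TwoConnection E M 𝒢) (x : M) (v : TangentSpace 𝓘(ℝ, E) x) : 𝒢.𝔤 :=
  ⟨c.A.toFun x v, c.A_mem x v⟩

/-- The data of a weak gauge transformation of the trivial 2-bundle: a smooth `G`-valued
function `g` and an `𝔥`-valued 1-form `a`. -/
structure WeakGauge (𝒢 : LieCrossedModule 𝒜 V) where
  g : M → 𝒢.G
  smooth_g : ContMDiff 𝓘(ℝ, E) 𝓘(ℝ, 𝒜) ∞ (fun x => ((g x : 𝒜ˣ) : 𝒜))
  a : OneForm E M V

variable {E M}

/-- The Maurer-Cartan type form `g dg⁻¹`. -/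
def gdgInv (g : M → 𝒜ˣ) (x : M) (v : TangentSpace 𝓘(ℝ, E) x) : 𝒜 :=
  let d : TangentSpace 𝓘(ℝ, E) x →L[ℝ] 𝒜 :=
    mfderiv 𝓘(ℝ, E) 𝓘(ℝ, 𝒜) (fun y => (((g y)⁻¹ : 𝒜ˣ) : 𝒜)) x
  (g x : 𝒜) * d v

/-- The weak gauge transformation `(g, a)` takes the 2-connection `c = (A, B)` to
`c' = (A', B')`:
`A' = g A g⁻¹ + g dg⁻¹ + dt(a)` and `B' = α(g)(B) + d_{A'} a + a ∧ a`, where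
`d_{A'} a = da + dα(A') ∧ a`.  The term `a ∧ a` is built from the Lie bracket of the abelian Lie
algebra `𝔥 = V`, so it is zero. -/
def WeakGauge.Transforms {𝒢 : LieCrossedModule 𝒜 V} (γ : WeakGauge E M 𝒢)
    (c c' : TwoConnection E M 𝒢) : Prop :=
  (∀ (x : M) (v : TangentSpace 𝓘(ℝ, E) x),
    c'.A.toFun x v =
      ((γ.g x : 𝒜ˣ) : 𝒜) * c.A.toFun x v * (((γ.g x)⁻¹ : 𝒜ˣ) : 𝒜)
        + gdgInv (fun y => (γ.g y : 𝒜ˣ)) x v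
        + (𝒢.dt (γ.a.toFun x v) : 𝒜)) ∧
  (∀ (x : M) (v w : TangentSpace 𝓘(ℝ, E) x),
    c'.B.toFun x v w =
      𝒢.α (γ.g x) (c.B.toFun x v w)
        + (extDer γ.a x v w
            + (𝒢.dα (c'.value x v) (γ.a.toFun x w) - 𝒢.dα (c'.value x w) (γ.a.toFun x v))))

end Gauge

/-! ### The groups `O(p,q)` and `IO(p,q)` -/

/-- The vector space `ℝ^{p,q}`; its metric is `eta`. -/
abbrev Rpq (p q : ℕ) : Type := Fin p ⊕ Fin q → ℝ

/-- The metric of signature `(p,q)`. -/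
def eta {p q : ℕ} (x y : Rpq p q) : ℝ :=
  ∑ i, x (Sum.inl i) * y (Sum.inl i) - ∑ j, x (Sum.inr j) * y (Sum.inr j)

/-- The algebra of linear endomorphisms of `ℝ^{p,q}`. -/
abbrev EndR (p q : ℕ) : Type := Rpq p q →L[ℝ] Rpq p q

/-- The algebra of linear endomorphisms of `ℝ^{p,q} × ℝ`, which contains the affine
transformations of `ℝ^{p,q}`, the latter being identified with the hyperplane
`ℝ^{p,q} × {1}`. -/
abbrev EndAff (p q : ℕ) : Type := (Rpq p q × ℝ) →L[ℝ] (Rpq p q × ℝ)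

/-- The Lorentz group `O(p,q)`: linear isometries of `ℝ^{p,q}`. -/
def lorentz (p q : ℕ) : Subgroup (EndR p q)ˣ where
  carrier := {h | ∀ x y, eta ((h : EndR p q) x) ((h : EndR p q) y) = eta x y}
  mul_mem' := by
    intro a b ha hb x y
    simp only [Set.mem_ofPred_eq] at ha hb
    simp [ha, hb]
  one_mem' := by intro x y; simp
  inv_mem' := by
    intro a ha x y
    simp only [Set.mem_ofPred_eq] at ha
    have key : ∀ z, (a : EndR p q) (((a⁻¹ : (EndR p q)ˣ) : EndR p q) z) = z := fun z => by
      rw [← mul_apply_eq_comp, Units.mul_inv, one_apply_eq_self]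
    rw [← ha, key, key]

lemma eta_add_left {p q : ℕ} (x x' y : Rpq p q) : eta (x + x') y = eta x y + eta x' y := by
  simp only [eta, Pi.add_apply, add_mul, Finset.sum_add_distrib]; ring

lemma eta_smul_left {p q : ℕ} (r : ℝ) (x y : Rpq p q) : eta (r • x) y = r * eta x y := by
  simp only [eta, Pi.smul_apply, smul_eq_mul, mul_sub, Finset.mul_sum, mul_assoc]

lemma eta_comm {p q : ℕ} (x y : Rpq p q) : eta x y = eta y x := by
  simp only [eta, mul_comm]

lemma eta_add_right {p q : ℕ} (x y y' : Rpq p q) : eta x (y + y') = eta x y + eta x y' := by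
  rw [eta_comm, eta_add_left, eta_comm y, eta_comm y']

lemma eta_smul_right {p q : ℕ} (r : ℝ) (x y : Rpq p q) : eta x (r • y) = r * eta x y := by
  rw [eta_comm, eta_smul_left, eta_comm]

/-- `eta` as a continuous bilinear map. -/
def etaL (p q : ℕ) : Rpq p q →L[ℝ] Rpq p q →L[ℝ] ℝ :=
  LinearMap.toContinuousLinearMap
    ((LinearMap.toContinuousLinearMap : (Rpq p q →ₗ[ℝ] ℝ) ≃ₗ[ℝ] _).toLinearMap.comp
      (LinearMap.mk₂ ℝ eta eta_add_left eta_smul_left eta_add_right eta_smul_right))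

lemma etaL_apply {p q : ℕ} (x y : Rpq p q) : etaL p q x y = eta x y := rfl

/-- The Lie algebra `𝔬(p,q)`. -/
def lorentzAlg (p q : ℕ) : Submodule ℝ (EndR p q) where
  carrier := {ξ | ∀ x y, eta (ξ x) y + eta x (ξ y) = 0}
  add_mem' := by
    intro a b ha hb x y
    simp only [Set.mem_ofPred_eq] at ha hb
    simp only [add_apply, eta_add_left, eta_add_right]
    linarith [ha x y, hb x y]
  zero_mem' := by intro x y; simp [eta]
  smul_mem' := by
    intro r a ha x y
    simp only [Set.mem_ofPred_eq] at ha
    simp only [smul_apply, eta_smul_left, eta_smul_right]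
    rw [← mul_add, ha, mul_zero]

lemma lorentzAlg_lie_mem {p q : ℕ} (a : EndR p q) (ha : a ∈ lorentzAlg p q) (b : EndR p q)
    (hb : b ∈ lorentzAlg p q) : a * b - b * a ∈ lorentzAlg p q := by
  intro x y
  have ha' : ∀ x y, eta (a x) y + eta x (a y) = 0 := ha
  have hb' : ∀ x y, eta (b x) y + eta x (b y) = 0 := hb
  have e : ∀ z, (a * b - b * a) z = a (b z) + (-1 : ℝ) • b (a z) := fun z => by
    simp [sub_eq_add_neg]
  rw [e, e]
  simp only [eta_add_left, eta_add_right, eta_smul_left, eta_smul_right]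
  linarith [ha' (b x) y, ha' x (b y), hb' (a x) y, hb' x (a y)]

/-- The linear map `(x, s) ↦ (ξ x + s u, c s)` of `ℝ^{p,q} × ℝ`, that is, the block matrix
with rows `(ξ, u)` and `(0, c)`. -/
def affBlock {p q : ℕ} (ξ : EndR p q) (u : Rpq p q) (c : ℝ) : EndAff p q :=
  (ξ.comp (ContinuousLinearMap.fst ℝ _ ℝ)
      + (ContinuousLinearMap.snd ℝ (Rpq p q) ℝ).smulRight u).prod
    (c • ContinuousLinearMap.snd ℝ _ ℝ)

@[simp] lemma affBlock_apply {p q : ℕ} (ξ : EndR p q) (u : Rpq p q) (c : ℝ)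
    (z : Rpq p q × ℝ) : affBlock ξ u c z = (ξ z.1 + z.2 • u, c * z.2) := rfl

lemma affBlock_mul {p q : ℕ} (ξ ξ' : EndR p q) (u u' : Rpq p q) (c c' : ℝ) :
    affBlock ξ u c * affBlock ξ' u' c' = affBlock (ξ * ξ') (ξ u' + c' • u) (c * c') := by
  refine ContinuousLinearMap.ext fun z => ?_
  simp only [mul_apply_eq_comp, affBlock_apply, map_add, map_smul, smul_add, smul_smul,
    Prod.mk.injEq]
  exact ⟨by rw [add_assoc, mul_comm c' z.2], by ring⟩

lemma affBlock_one {p q : ℕ} : affBlock (1 : EndR p q) 0 1 = 1 := by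
  refine ContinuousLinearMap.ext fun z => ?_
  simp

/-- The linear part of an endomorphism of `ℝ^{p,q} × ℝ`. -/
def linPart {p q : ℕ} (X : EndAff p q) : EndR p q :=
  (ContinuousLinearMap.fst ℝ _ ℝ).comp (X.comp (ContinuousLinearMap.inl ℝ _ ℝ))

/-- The translation part of an endomorphism of `ℝ^{p,q} × ℝ`. -/
def transPart {p q : ℕ} (X : EndAff p q) : Rpq p q := (X (0, 1)).1

@[simp] lemma linPart_affBlock {p q : ℕ} (ξ : EndR p q) (u : Rpq p q) (c : ℝ) :
    linPart (affBlock ξ u c) = ξ := by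
  refine ContinuousLinearMap.ext fun z => ?_
  simp [linPart]

@[simp] lemma transPart_affBlock {p q : ℕ} (ξ : EndR p q) (u : Rpq p q) (c : ℝ) :
    transPart (affBlock ξ u c) = u := by
  simp [transPart]

/-- The affine transformation `(h, v) : x ↦ h x + v`. -/
def affUnit {p q : ℕ} (h : (EndR p q)ˣ) (v : Rpq p q) : (EndAff p q)ˣ where
  val := affBlock h v 1
  inv := affBlock (h⁻¹ : (EndR p q)ˣ) (-(((h⁻¹ : (EndR p q)ˣ) : EndR p q) v)) 1
  val_inv := by
    have key : (h : EndR p q) (((h⁻¹ : (EndR p q)ˣ) : EndR p q) v) = v := by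
      rw [← mul_apply_eq_comp, Units.mul_inv, one_apply_eq_self]
    rw [affBlock_mul, Units.mul_inv, ← affBlock_one, map_neg, key]; simp
  inv_val := by
    rw [affBlock_mul, Units.inv_mul, ← affBlock_one]; simp

lemma affUnit_mul {p q : ℕ} (h h' : (EndR p q)ˣ) (v v' : Rpq p q) :
    affUnit h v * affUnit h' v' = affUnit (h * h') (v + (h : EndR p q) v') := by
  ext1
  simp only [Units.val_mul, affUnit]
  rw [affBlock_mul]; simp [add_comm]

lemma affUnit_one {p q : ℕ} : affUnit (1 : (EndR p q)ˣ) 0 = 1 := by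
  ext1; exact affBlock_one

lemma affUnit_inv {p q : ℕ} (h : (EndR p q)ˣ) (v : Rpq p q) :
    (affUnit h v)⁻¹ = affUnit h⁻¹ (-(((h⁻¹ : (EndR p q)ˣ) : EndR p q) v)) := by
  ext1; rfl

/-- The Poincaré group `IO(p,q) = O(p,q) ⋉ ℝ^{p,q}`, with the multiplication
`(h, v) (h', v') = (h h', v + h v')`. -/
def poincare (p q : ℕ) : Subgroup (EndAff p q)ˣ where
  carrier := {g | ∃ h ∈ lorentz p q, ∃ v, g = affUnit h v}
  mul_mem' := by
    rintro _ _ ⟨h, hh, v, rfl⟩ ⟨h', hh', v', rfl⟩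
    exact ⟨h * h', mul_mem hh hh', _, affUnit_mul _ _ _ _⟩
  one_mem' := ⟨1, one_mem _, 0, affUnit_one.symm⟩
  inv_mem' := by
    rintro _ ⟨h, hh, v, rfl⟩
    exact ⟨h⁻¹, inv_mem hh, _, affUnit_inv _ _⟩

/-- The Lie algebra `𝔦𝔬(p,q) = 𝔬(p,q) ⊕ ℝ^{p,q}`: block matrices with rows `(ξ, u)` and
`(0, 0)`. -/
def poincareAlg (p q : ℕ) : Submodule ℝ (EndAff p q) where
  carrier := {X | ∃ ξ ∈ lorentzAlg p q, ∃ u, X = affBlock ξ u 0}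
  add_mem' := by
    rintro _ _ ⟨ξ, hξ, u, rfl⟩ ⟨ξ', hξ', u', rfl⟩
    refine ⟨ξ + ξ', add_mem hξ hξ', u + u', ContinuousLinearMap.ext fun z => ?_⟩
    simp [add_add_add_comm]
  zero_mem' := ⟨0, zero_mem _, 0, ContinuousLinearMap.ext fun z => by simp; rfl⟩
  smul_mem' := by
    rintro r _ ⟨ξ, hξ, u, rfl⟩
    refine ⟨r • ξ, (lorentzAlg p q).smul_mem r hξ, r • u, ContinuousLinearMap.ext fun z => ?_⟩
    simp [smul_comm r]

lemma poincareAlg_lie_mem {p q : ℕ} (X : EndAff p q) (hX : X ∈ poincareAlg p q) (Y : EndAff p q)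
    (hY : Y ∈ poincareAlg p q) : X * Y - Y * X ∈ poincareAlg p q := by
  obtain ⟨ξ, hξ, u, rfl⟩ := hX
  obtain ⟨ξ', hξ', u', rfl⟩ := hY
  refine ⟨ξ * ξ' - ξ' * ξ, lorentzAlg_lie_mem _ hξ _ hξ', ξ u' - ξ' u, ?_⟩
  rw [affBlock_mul, affBlock_mul]
  refine ContinuousLinearMap.ext fun z => ?_
  simp only [sub_apply, affBlock_apply, zero_smul, add_zero, mul_zero,
    zero_mul, Prod.mk_sub_mk, sub_zero, smul_sub]
  rw [add_sub_add_comm]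

lemma mem_lorentzAlg_iff {p q : ℕ} (X : EndR p q) :
    X ∈ lorentzAlg p q ↔
      ∀ s : ℝ, ∃ g ∈ lorentz p q, (g : EndR p q) = NormedSpace.exp (s • X) := by
  have hd : ∀ (s : ℝ) (x : Rpq p q), HasDerivAt (fun s : ℝ => NormedSpace.exp (s • X) x)
      (X (NormedSpace.exp (s • X) x)) s := fun s x => by
    have h := (hasDerivAt_exp_smul_const' (𝕂 := ℝ) X s).clm_apply (hasDerivAt_const s x)
    simpa using h
  have hq : ∀ (s : ℝ) (x y : Rpq p q),
      HasDerivAt (fun s : ℝ => eta (NormedSpace.exp (s • X) x) (NormedSpace.exp (s • X) y))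
        (eta (X (NormedSpace.exp (s • X) x)) (NormedSpace.exp (s • X) y)
          + eta (NormedSpace.exp (s • X) x) (X (NormedSpace.exp (s • X) y))) s := by
    intro s x y
    exact ((etaL p q).hasFDerivAt.comp_hasDerivAt s (hd s x)).clm_apply (hd s y)
  constructor
  · intro hX s
    let _ : NormedAlgebra ℚ (EndR p q) := NormedAlgebra.restrictScalars ℚ ℝ (EndR p q)
    obtain ⟨g, hg⟩ := NormedSpace.isUnit_exp (s • X)
    refine ⟨g, fun x y => ?_, hg⟩
    rw [hg]
    have hc := is_const_of_deriv_eq_zero (fun s => (hq s x y).differentiableAt)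
      (fun s => by rw [(hq s x y).deriv]; exact hX _ _) s 0
    simpa using hc
  · intro h x y
    have h0 := hq 0 x y
    have e : (fun s : ℝ => eta (NormedSpace.exp (s • X) x) (NormedSpace.exp (s • X) y))
        = fun _ => eta x y := by
      funext s
      obtain ⟨g, hg, hgs⟩ := h s
      rw [← hgs]; exact hg x y
    rw [e] at h0
    simpa using h0.unique (hasDerivAt_const (0 : ℝ) (eta x y))

lemma isClosed_lorentz (p q : ℕ) : IsClosed (lorentz p q : Set (EndR p q)ˣ) := by
  have e : (lorentz p q : Set (EndR p q)ˣ)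
      = ⋂ x, ⋂ y, {h : (EndR p q)ˣ | etaL p q ((h : EndR p q) x) ((h : EndR p q) y)
          = etaL p q x y} := by
    ext h
    simp only [Set.mem_iInter]
    rfl
  rw [e]
  refine isClosed_iInter fun x => isClosed_iInter fun y => isClosed_eq ?_ continuous_const
  have h1 : Continuous fun h : (EndR p q)ˣ => (h : EndR p q) := Units.continuous_val
  fun_prop

/-- The crossed module of the Poincaré 2-group `Poinc(p,q)`: `G = O(p,q)`, `H = ℝ^{p,q}`,
`t` is trivial and `α` is the obvious representation. -/
def Poinc (p q : ℕ) : LieCrossedModule (EndR p q) (Rpq p q) where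
  G := lorentz p q
  isClosed := isClosed_lorentz p q
  t := 1
  continuous_t := continuous_const
  α := (Units.coeHom (EndR p q)).comp (lorentz p q).subtype
  continuous_α := Units.continuous_val.comp continuous_subtype_val
  equivariance := by simp
  peiffer := by simp
  𝔤 := lorentzAlg p q
  mem_𝔤 := mem_lorentzAlg_iff
  lie_mem_𝔤 := lorentzAlg_lie_mem
  dt := 0
  hasDeriv_t := fun v => by
    simpa using hasDerivAt_const (0 : ℝ) (1 : EndR p q)
  dα := (lorentzAlg p q).subtype
  hasDeriv_α := fun X γ hγ => by
    have h := hasDerivAt_exp_smul_const (𝕂 := ℝ) (X : EndR p q) 0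
    simp only [zero_smul, NormedSpace.exp_zero, one_mul] at h
    exact h.congr_of_eventuallyEq (Filter.Eventually.of_forall hγ)

lemma mem_poincare_iff {p q : ℕ} (g : (EndAff p q)ˣ) :
    g ∈ poincare p q ↔ (∀ z, ((g : EndAff p q) z).2 = z.2) ∧
      ∀ x y, eta (linPart (g : EndAff p q) x) (linPart (g : EndAff p q) y) = eta x y := by
  constructor
  · rintro ⟨h, hh, v, rfl⟩
    refine ⟨fun z => by simp [affUnit], fun x y => ?_⟩
    simpa [affUnit] using hh x y
  · rintro ⟨h1, h2⟩
    have key : ∀ z, (g : EndAff p q) (((g⁻¹ : (EndAff p q)ˣ) : EndAff p q) z) = z := fun z => by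
      rw [← mul_apply_eq_comp, Units.mul_inv, one_apply_eq_self]
    have key' : ∀ z, ((g⁻¹ : (EndAff p q)ˣ) : EndAff p q) ((g : EndAff p q) z) = z := fun z => by
      rw [← mul_apply_eq_comp, Units.inv_mul, one_apply_eq_self]
    have h1' : ∀ z, (((g⁻¹ : (EndAff p q)ˣ) : EndAff p q) z).2 = z.2 := fun z => by
      rw [← h1, key]
    have hl : ∀ x, (g : EndAff p q) (x, 0) = (linPart (g : EndAff p q) x, 0) := fun x =>
      Prod.ext rfl (h1 _)
    have hl' : ∀ x, ((g⁻¹ : (EndAff p q)ˣ) : EndAff p q) (x, 0)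
        = (linPart ((g⁻¹ : (EndAff p q)ˣ) : EndAff p q) x, 0) := fun x => Prod.ext rfl (h1' _)
    let h : (EndR p q)ˣ :=
      { val := linPart (g : EndAff p q)
        inv := linPart ((g⁻¹ : (EndAff p q)ˣ) : EndAff p q)
        val_inv := ContinuousLinearMap.ext fun x => by
          have := key (x, 0)
          rw [hl', hl] at this
          exact congrArg Prod.fst this
        inv_val := ContinuousLinearMap.ext fun x => by
          have := key' (x, 0)
          rw [hl, hl'] at this
          exact congrArg Prod.fst this }
    refine ⟨h, h2, transPart (g : EndAff p q), ?_⟩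
    ext1
    refine ContinuousLinearMap.ext fun z => ?_
    have hz : z = (z.1, 0) + z.2 • ((0, 1) : Rpq p q × ℝ) := by ext <;> simp
    refine Prod.ext ?_ (by rw [h1]; simp [affUnit])
    conv_lhs => rw [hz, map_add, map_smul, hl]
    rfl

lemma mem_poincareAlg_iff' {p q : ℕ} (X : EndAff p q) :
    X ∈ poincareAlg p q ↔ (∀ z, (X z).2 = 0) ∧ linPart X ∈ lorentzAlg p q := by
  constructor
  · rintro ⟨ξ, hξ, u, rfl⟩
    exact ⟨fun z => by simp, by simpa using hξ⟩
  · rintro ⟨h1, h2⟩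
    refine ⟨_, h2, transPart X, ContinuousLinearMap.ext fun z => ?_⟩
    have hz : z = (z.1, 0) + z.2 • ((0, 1) : Rpq p q × ℝ) := by ext <;> simp
    refine Prod.ext ?_ (by rw [h1]; simp)
    conv_lhs => rw [hz, map_add, map_smul]
    rfl

lemma mem_poincareAlg_iff {p q : ℕ} (X : EndAff p q) :
    X ∈ poincareAlg p q ↔
      ∀ s : ℝ, ∃ g ∈ poincare p q, (g : EndAff p q) = NormedSpace.exp (s • X) := by
  have hd : ∀ (s : ℝ) (z : Rpq p q × ℝ), HasDerivAt (fun s : ℝ => NormedSpace.exp (s • X) z)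
      (X (NormedSpace.exp (s • X) z)) s := fun s z => by
    have h := (hasDerivAt_exp_smul_const' (𝕂 := ℝ) X s).clm_apply (hasDerivAt_const s z)
    simpa using h
  have hd2 : ∀ (s : ℝ) (z : Rpq p q × ℝ),
      HasDerivAt (fun s : ℝ => (NormedSpace.exp (s • X) z).2)
        (X (NormedSpace.exp (s • X) z)).2 s := fun s z =>
    (ContinuousLinearMap.snd ℝ (Rpq p q) ℝ).hasFDerivAt.comp_hasDerivAt s (hd s z)
  have hd1 : ∀ (s : ℝ) (z : Rpq p q × ℝ),
      HasDerivAt (fun s : ℝ => (NormedSpace.exp (s • X) z).1)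
        (X (NormedSpace.exp (s • X) z)).1 s := fun s z =>
    (ContinuousLinearMap.fst ℝ (Rpq p q) ℝ).hasFDerivAt.comp_hasDerivAt s (hd s z)
  have hq : ∀ (s : ℝ) (x y : Rpq p q),
      HasDerivAt (fun s : ℝ => eta (NormedSpace.exp (s • X) (x, 0)).1
          (NormedSpace.exp (s • X) (y, 0)).1)
        (eta (X (NormedSpace.exp (s • X) (x, 0))).1 (NormedSpace.exp (s • X) (y, 0)).1
          + eta (NormedSpace.exp (s • X) (x, 0)).1 (X (NormedSpace.exp (s • X) (y, 0))).1) s := by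
    intro s x y
    exact ((etaL p q).hasFDerivAt.comp_hasDerivAt s (hd1 s (x, 0))).clm_apply (hd1 s (y, 0))
  rw [mem_poincareAlg_iff']
  constructor
  · rintro ⟨h1, h2⟩ s
    let _ : NormedAlgebra ℚ (EndAff p q) := NormedAlgebra.restrictScalars ℚ ℝ (EndAff p q)
    obtain ⟨g, hg⟩ := NormedSpace.isUnit_exp (s • X)
    have hsnd : ∀ (s : ℝ) z, (NormedSpace.exp (s • X) z).2 = z.2 := fun s z => by
      have hc := is_const_of_deriv_eq_zero (fun s => (hd2 s z).differentiableAt)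
        (fun s => by rw [(hd2 s z).deriv]; exact h1 _) s 0
      simpa using hc
    refine ⟨g, (mem_poincare_iff g).2 ⟨fun z => by rw [hg, hsnd], fun x y => ?_⟩, hg⟩
    rw [hg]
    have hz : ∀ (s : ℝ) x, NormedSpace.exp (s • X) (x, 0)
        = ((NormedSpace.exp (s • X) (x, 0)).1, 0) := fun s x => Prod.ext rfl (hsnd s _)
    have hc := is_const_of_deriv_eq_zero (fun s => (hq s x y).differentiableAt)
      (fun s => by
        rw [(hq s x y).deriv, hz s x, hz s y]
        exact h2 _ _) s 0
    simp only [zero_smul, NormedSpace.exp_zero, one_apply_eq_self] at hc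
    exact hc
  · intro h
    refine ⟨fun z => ?_, fun x y => ?_⟩
    · have h0 := hd2 0 z
      have e : (fun s : ℝ => (NormedSpace.exp (s • X) z).2) = fun _ => z.2 := by
        funext s
        obtain ⟨g, hg, hgs⟩ := h s
        rw [← hgs]; exact ((mem_poincare_iff g).1 hg).1 z
      rw [e] at h0
      simpa using h0.unique (hasDerivAt_const (0 : ℝ) z.2)
    · have h0 := hq 0 x y
      have e : (fun s : ℝ => eta (NormedSpace.exp (s • X) (x, 0)).1
          (NormedSpace.exp (s • X) (y, 0)).1) = fun _ => eta x y := by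
        funext s
        obtain ⟨g, hg, hgs⟩ := h s
        rw [← hgs]; exact ((mem_poincare_iff g).1 hg).2 x y
      rw [e] at h0
      have h3 := h0.unique (hasDerivAt_const (0 : ℝ) (eta x y))
      simp only [zero_smul, NormedSpace.exp_zero, one_apply_eq_self] at h3
      exact h3

lemma isClosed_poincare (p q : ℕ) : IsClosed (poincare p q : Set (EndAff p q)ˣ) := by
  have e : (poincare p q : Set (EndAff p q)ˣ)
      = (⋂ z, {g : (EndAff p q)ˣ | ((g : EndAff p q) z).2 = z.2}) ∩
        ⋂ x, ⋂ y, {g : (EndAff p q)ˣ | etaL p q ((g : EndAff p q) (x, 0)).1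
          ((g : EndAff p q) (y, 0)).1 = etaL p q x y} := by
    ext g
    simp only [Set.mem_iInter, Set.mem_inter_iff]
    exact mem_poincare_iff g
  rw [e]
  have h1 : Continuous fun h : (EndAff p q)ˣ => (h : EndAff p q) := Units.continuous_val
  refine IsClosed.inter (isClosed_iInter fun z => isClosed_eq (by fun_prop) continuous_const)
    (isClosed_iInter fun x => isClosed_iInter fun y => isClosed_eq ?_ continuous_const)
  fun_prop

/-- The representation `(h, v) w = h w` of `IO(p,q)` on `ℝ^{p,q}`. -/
def poincareRep (p q : ℕ) : poincare p q →* EndR p q where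
  toFun g := linPart ((g : (EndAff p q)ˣ) : EndAff p q)
  map_one' := ContinuousLinearMap.ext fun x => by simp [linPart]
  map_mul' := by
    rintro ⟨_, h, hh, v, rfl⟩ ⟨_, h', hh', v', rfl⟩
    simp only [Subgroup.coe_mul, Units.val_mul, affUnit, affBlock_mul, linPart_affBlock]

/-- The inclusion `v ↦ (1, v)` of the translation group in `IO(p,q)`. -/
def translation (p q : ℕ) : Multiplicative (Rpq p q) →* poincare p q where
  toFun v := ⟨affUnit 1 v.toAdd, 1, one_mem _, _, rfl⟩
  map_one' := Subtype.ext affUnit_one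
  map_mul' v w := Subtype.ext (by simp [affUnit_mul])

/-- The inclusion `u ↦ (0, u)` of `ℝ^{p,q}` in `𝔦𝔬(p,q)`. -/
def translationAlg (p q : ℕ) : Rpq p q →ₗ[ℝ] poincareAlg p q where
  toFun u := ⟨affBlock 0 u 0, 0, zero_mem _, u, rfl⟩
  map_add' u v := Subtype.ext (ContinuousLinearMap.ext fun z => by simp)
  map_smul' r u := Subtype.ext (ContinuousLinearMap.ext fun z => by simp [smul_comm r])

/-- The representation `(ξ, u) w = ξ w` of `𝔦𝔬(p,q)` on `ℝ^{p,q}`. -/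
def poincareAlgRep (p q : ℕ) : poincareAlg p q →ₗ[ℝ] EndR p q where
  toFun X := linPart (X : EndAff p q)
  map_add' _ _ := rfl
  map_smul' _ _ := rfl

/-- The crossed module of the teleparallel 2-group `Tel(p,q)`: `G = IO(p,q)`, `H = ℝ^{p,q}`,
`t` is the inclusion of the translations and `α(h, v) w = h w`. -/
def Tel (p q : ℕ) : LieCrossedModule (EndAff p q) (Rpq p q) where
  G := poincare p q
  isClosed := isClosed_poincare p q
  t := translation p q
  continuous_t := by
    let L : Rpq p q →ₗ[ℝ] EndAff p q := (poincareAlg p q).subtype.comp (translationAlg p q)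
    have hL : Continuous L := L.continuous_of_finiteDimensional
    have e : ∀ v, affBlock (1 : EndR p q) v 1 = 1 + L v := fun v =>
      ContinuousLinearMap.ext fun z => by
        ext <;> simp [L, translationAlg]
    refine Continuous.subtype_mk (Units.continuous_iff.2 ⟨?_, ?_⟩) _
    · change Continuous fun v : Rpq p q => affBlock (1 : EndR p q) v 1
      simp only [e]
      fun_prop
    · change Continuous fun v : Rpq p q => affBlock (1 : EndR p q) (-v) 1
      simp only [e]
      fun_prop
  α := poincareRep p q
  continuous_α := by
    have h : Continuous fun g : poincare p q => ((g : (EndAff p q)ˣ) : EndAff p q) :=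
      Units.continuous_val.comp continuous_subtype_val
    change Continuous fun g : poincare p q => linPart ((g : (EndAff p q)ˣ) : EndAff p q)
    unfold linPart
    fun_prop
  equivariance := by
    rintro ⟨_, h, hh, v, rfl⟩ w
    rw [eq_mul_inv_iff_mul_eq]
    refine Subtype.ext ?_
    change affUnit 1 (linPart (affUnit h v : EndAff p q) w) * affUnit h v
      = affUnit h v * affUnit 1 w
    rw [affUnit_mul, affUnit_mul]
    simp [affUnit, add_comm]
  peiffer := fun v w => by
    change linPart (affBlock 1 v 1) w = _
    simp
  𝔤 := poincareAlg p q
  mem_𝔤 := mem_poincareAlg_iff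
  lie_mem_𝔤 := poincareAlg_lie_mem
  dt := translationAlg p q
  hasDeriv_t := fun v => by
    change HasDerivAt (fun s : ℝ => affBlock 1 (s • v) 1) (affBlock 0 v 0) 0
    have e : (fun s : ℝ => affBlock (1 : EndR p q) (s • v) 1)
        = fun s : ℝ => 1 + s • affBlock 0 v 0 := by
      funext s
      refine ContinuousLinearMap.ext fun z => ?_
      ext <;> simp [mul_left_comm]
    rw [e]
    simpa using ((hasDerivAt_id (0 : ℝ)).smul_const (affBlock 0 v 0)).const_add 1
  dα := poincareAlgRep p q
  hasDeriv_α := fun X γ hγ => by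
    have h := hasDerivAt_exp_smul_const (𝕂 := ℝ) (X : EndAff p q) 0
    simp only [zero_smul, NormedSpace.exp_zero, one_mul] at h
    let L : EndAff p q →ₗ[ℝ] EndR p q :=
      { toFun := linPart, map_add' := fun _ _ => rfl, map_smul' := fun _ _ => rfl }
    have h' := L.toContinuousLinearMap.hasFDerivAt.comp_hasDerivAt (0 : ℝ) h
    refine h'.congr_of_eventuallyEq (Filter.Eventually.of_forall fun s => ?_)
    change linPart ((γ s : (EndAff p q)ˣ) : EndAff p q) = _
    rw [hγ]; rfl

/-! ### Weak `Poinc(p,q)` gauge transformations of `Tel(p,q)` 2-connections -/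

section TelGauge

variable {E : Type*} [NormedAddCommGroup E] [NormedSpace ℝ E]
  {M : Type*} [TopologicalSpace M] [ChartedSpace E M] {p q : ℕ}

/-- The `𝔬(p,q)`-part `ω` of the 1-form `A = (ω, e)` of a `Tel(p,q)` 2-connection. -/
def TwoConnection.ω (c : TwoConnection E M (Tel p q)) (x : M) (v : TangentSpace 𝓘(ℝ, E) x) :
    EndR p q :=
  linPart (c.A.toFun x v)

/-- The `ℝ^{p,q}`-part `e` of the 1-form `A = (ω, e)` of a `Tel(p,q)` 2-connection. -/
def TwoConnection.e (c : TwoConnection E M (Tel p q)) (x : M) (v : TangentSpace 𝓘(ℝ, E) x) :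
    Rpq p q :=
  transPart (c.A.toFun x v)

/-- A weak `Poinc(p,q)` gauge transformation `(h, a)`, regarded as the weak `Tel(p,q)` gauge
transformation `(g, a)` with `g = (h, 0)`, that is, with translation part `v = 0`. -/
def WeakGauge.toTel (γ : WeakGauge E M (Poinc p q)) : WeakGauge E M (Tel p q) where
  g x := ⟨affUnit (γ.g x : (EndR p q)ˣ) 0, _, (γ.g x).2, 0, rfl⟩
  smooth_g := by
    let L : EndR p q →ₗ[ℝ] EndAff p q :=
      { toFun := fun ξ => affBlock ξ 0 0
        map_add' := fun ξ ξ' => ContinuousLinearMap.ext fun z => by simp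
        map_smul' := fun r ξ => ContinuousLinearMap.ext fun z => by simp }
    have e : (fun x => affBlock ((γ.g x : (EndR p q)ˣ) : EndR p q) 0 1)
        = fun x => L.toContinuousLinearMap ((γ.g x : (EndR p q)ˣ) : EndR p q)
          + affBlock 0 0 1 := by
      funext x
      refine ContinuousLinearMap.ext fun z => ?_
      ext <;> simp [L]
    change ContMDiff 𝓘(ℝ, E) 𝓘(ℝ, EndAff p q) ∞
      (fun x => affBlock ((γ.g x : (EndR p q)ˣ) : EndR p q) 0 1)
    rw [e]
    have h1 : ContDiff ℝ ∞ (fun ξ : EndR p q => L.toContinuousLinearMap ξ + affBlock 0 0 1) := by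
      fun_prop
    exact h1.contMDiff.comp γ.smooth_g
  a := γ.a

end TelGauge

end HigherGauge

end

noncomputable section

namespace HigherGauge

/-! ### Radial solutions of a flat linear system. -/

section LocalSolution

open Set Metric

variable {E : Type*} [NormedAddCommGroup E] [NormedSpace ℝ E]
  {𝒜 : Type*} [NormedRing 𝒜] [NormedAlgebra ℝ 𝒜]

/-! Split `dA + A ∧ A = dt(B)` along `𝔬(p,q) ⊕ ℝ^{p,q}`. Since `dt` takes values in translations,
the linear part says that `ω` is flat (`extDer_lin`), and the translation part says `B = d_ω e`
(`extDer_trans`). A `Tel(p,q)` 2-connection is thus a flat `ω` with an arbitrary `e`, and `B` is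
determined by them.

Over a manifold with trivial fundamental groups, a flat `ω` has a global `k : M → O(p,q)` with `dk =
-ω k` (`exists_parallel`). Given such `k`, `k'` for `ω`, `ω'`, put `h = k' k⁻¹`. Then `dh = h ω - ω'
h`, which is the gauge law for `ω`; it also makes `h` smooth by bootstrapping
(`contDiffOn_of_intertwining`). With `a = e' - h e` the law for `e` is immediate, and the law for
`B` follows from `B = d_ω e`, `B' = d_ω' e'` and the Leibniz rule (`extDer_subAct`,
`curvature_identity`).

Locally, `k` comes from solving the system along rays from a point and taking endpoints; flatness
makes the endpoint map a solution in all directions (`norm_radial_sub_le`, `hasFDerivAt_radial`). It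
stays in `O(p,q)` because `eta` is conserved. Globally, local solutions differ by locally constant
factors, so they define a bundle with discrete fibre, that is, a covering of `M`. It has a section
because loops are trivial, and the section corrects the local solutions to one global solution
(`exists_locally_constant_correction`). -/

lemma add_smul_sub_mem_ball {y₀ y : E} {r t : ℝ} (hy : y ∈ ball y₀ r) (ht : t ∈ Icc (0 : ℝ) 1) :
    y₀ + t • (y - y₀) ∈ ball y₀ r := by
  rw [mem_ball_iff_norm] at hy ⊢
  rw [add_sub_cancel_left, norm_smul, Real.norm_of_nonneg ht.1]
  exact (mul_le_of_le_one_left (norm_nonneg _) ht.2).trans_lt hy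

/-- Second order Taylor estimate for a function with Lipschitz derivative. -/
lemma norm_taylor_le {F : Type*} [NormedAddCommGroup F] [NormedSpace ℝ F] {Ω : E → F}
    {DΩ : E → E →L[ℝ] F} {s : Set E} (hs : Convex ℝ s) {C : ℝ} (hC : 0 ≤ C)
    (hΩ : ∀ y ∈ s, HasFDerivAt Ω (DΩ y) y)
    (hlip : ∀ y ∈ s, ∀ y' ∈ s, ‖DΩ y - DΩ y'‖ ≤ C * ‖y - y'‖) {x x' : E} (hx : x ∈ s)
    (hx' : x' ∈ s) : ‖Ω x' - Ω x - DΩ x (x' - x)‖ ≤ C * ‖x' - x‖ ^ 2 := by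
  have hseg : segment ℝ x x' ⊆ s := hs.segment_subset hx hx'
  have h := (convex_segment (𝕜 := ℝ) x x').norm_image_sub_le_of_norm_hasFDerivWithin_le'
    (f := Ω) (f' := DΩ) (φ := DΩ x) (C := C * ‖x' - x‖)
    (fun y hy => (hΩ y (hseg hy)).hasFDerivWithinAt)
    (fun y hy => (hlip y (hseg hy) x hx).trans (by
      gcongr
      obtain ⟨t, ht, rfl⟩ := (segment_eq_image' ℝ x x' ▸ hy)
      rw [add_sub_cancel_left, norm_smul, Real.norm_of_nonneg ht.1]
      exact mul_le_of_le_one_left (norm_nonneg _) ht.2))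
    (left_mem_segment ℝ x x') (right_mem_segment ℝ x x')
  rwa [mul_assoc, ← sq] at h

/-- A linear Grönwall estimate on the unit interval. -/
lemma norm_le_gronwallBound_mul {F : Type*} [NormedAddCommGroup F] [NormedSpace ℝ F]
    {f f' : ℝ → F} {K ε : ℝ} (hf : ∀ t ∈ Icc (0 : ℝ) 1, HasDerivWithinAt f (f' t) (Icc 0 1) t)
    (h0 : f 0 = 0) (hb : ∀ t ∈ Icc (0 : ℝ) 1, ‖f' t‖ ≤ K * ‖f t‖ + ε) :
    ‖f 1‖ ≤ gronwallBound 0 K 1 1 * ε := by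
  have h := norm_le_gronwallBound_of_norm_deriv_right_le (f := f) (f' := f') (δ := 0) (K := K)
    (ε := ε) (a := 0) (b := 1) (fun t ht => (hf t ht).continuousWithinAt)
    (fun t ht => (hf t ⟨ht.1, ht.2.le⟩).mono_of_mem_nhdsWithin (Icc_mem_nhdsGE_of_mem ht))
    (by simp [h0]) (fun t ht => hb t ⟨ht.1, ht.2.le⟩) 1 (by simp)
  refine h.trans (le_of_eq ?_)
  -- With initial value `0` the Grönwall bound is linear in `ε`, whether or not `K` vanishes.
  simp only [gronwallBound]
  split_ifs <;> simp; ring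

/-- The defect of the approximate solution `a + Ω(τ) a` of `du = Ω u` near a radial solution. -/
lemma norm_radial_deriv_le {α β : E →L[ℝ] 𝒜} {D : E →L[ℝ] E →L[ℝ] 𝒜} {d z τ : E} {a b : 𝒜}
    {r C N : ℝ} (hC : 0 ≤ C) (hr : 0 ≤ r) (hdr : ‖d‖ ≤ r) (hdzr : ‖d + z‖ ≤ r)
    (hzr : ‖z‖ ≤ 2 * r) (hτ : ‖τ‖ ≤ ‖z‖) (hα : ‖α‖ ≤ C) (hD : ‖D‖ ≤ C) (hβ : ‖β‖ ≤ C)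
    (ha : ‖a‖ ≤ N) (hT : ‖β - α - D τ‖ ≤ C * ‖z‖ * ‖z‖) (hL : ‖β - α‖ ≤ C * ‖z‖)
    (hF : D τ d - D d τ = α τ * α d - α d * α τ) :
    ‖β (d + z) * b - (α d * a + ((D d τ + α z) * a + α τ * (α d * a)))‖
      ≤ C * r * ‖b - (a + α τ * a)‖
        + (C * (r + 1) * (N + C * (2 * r) * N) + (C + C * r) * C * N) * ‖z‖ ^ 2 := by
  have hN : 0 ≤ N := (norm_nonneg _).trans ha
  have hTd : ‖(β - α - D τ) d‖ ≤ C * ‖z‖ * ‖z‖ * r :=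
    (ContinuousLinearMap.le_opNorm _ _).trans (by gcongr)
  have hLz : ‖(β - α) z‖ ≤ C * ‖z‖ * ‖z‖ :=
    (ContinuousLinearMap.le_opNorm _ _).trans (by gcongr)
  have e1 : ‖β (d + z)‖ ≤ C * r :=
    (ContinuousLinearMap.le_opNorm _ _).trans (by gcongr)
  have e2 : ‖α z‖ ≤ C * ‖z‖ := (ContinuousLinearMap.le_opNorm _ _).trans (by gcongr)
  have e3 : ‖α τ‖ ≤ C * ‖z‖ := (ContinuousLinearMap.le_opNorm _ _).trans (by gcongr)
  have e4 : ‖D τ d‖ ≤ C * ‖z‖ * r :=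
    (ContinuousLinearMap.le_opNorm₂ _ _ _).trans (by gcongr)
  have e5 : ‖a + α τ * a‖ ≤ N + C * (2 * r) * N := by
    refine (norm_add_le _ _).trans (add_le_add ha ((norm_mul_le _ _).trans ?_))
    gcongr
    exact e3.trans (by gcongr)
  -- Here `α`, `β` are `Ω` at corresponding points of the two rays, `D` is the derivative of `Ω` at
  -- the first, and `a`, `b` are the two radial solutions. Flatness trades `D d τ` for `D τ d` plus
  -- a commutator, which cancels all first-order terms. What remains is a multiple of the error, a
  -- Taylor remainder, and a product of two factors of order `‖z‖`.
  have hdec : β (d + z) * b - (α d * a + ((D d τ + α z) * a + α τ * (α d * a)))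
      = β (d + z) * (b - (a + α τ * a))
        + (((β - α - D τ) d + (β - α) z) * (a + α τ * a)
          + (α z + D τ d) * (α τ * a)) := by
    have hF' : D d τ = D τ d - (α τ * α d - α d * α τ) := by
      rw [← hF]; abel
    rw [hF', map_add]
    change _ = _ + ((β d - α d - D τ d + (β z - α z)) * _ + _)
    generalize β d = p1
    generalize α d = p2
    generalize β z = p3
    generalize α z = p4
    generalize α τ = p5
    generalize D τ d = p6
    simp only [mul_add, add_mul, sub_mul, mul_sub, mul_assoc]
    abel
  have e6 : ‖((β - α - D τ) d + (β - α) z) * (a + α τ * a)‖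
      ≤ (C * ‖z‖ * ‖z‖ * r + C * ‖z‖ * ‖z‖) * (N + C * (2 * r) * N) :=
    (norm_mul_le _ _).trans (mul_le_mul ((norm_add_le _ _).trans (add_le_add hTd hLz)) e5
      (norm_nonneg _) (by positivity))
  have e7 : ‖(α z + D τ d) * (α τ * a)‖ ≤ (C * ‖z‖ + C * ‖z‖ * r) * (C * ‖z‖ * N) :=
    (norm_mul_le _ _).trans (mul_le_mul ((norm_add_le _ _).trans (add_le_add e2 e4))
      ((norm_mul_le _ _).trans (mul_le_mul e3 ha (norm_nonneg _) (by positivity)))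
      (norm_nonneg _) (by positivity))
  rw [hdec]
  refine (norm_add_le _ _).trans (add_le_add ((norm_mul_le _ _).trans (by gcongr)) ?_)
  exact (norm_add_le _ _).trans ((add_le_add e6 e7).trans (le_of_eq (by ring)))

/-- The comparison estimate behind the differentiability of the radial solution of a flat linear
system `du = Ω u`. -/
lemma norm_radial_sub_le {Ω : E → E →L[ℝ] 𝒜} {DΩ : E → E →L[ℝ] E →L[ℝ] 𝒜} {y₀ : E} {r C N : ℝ}
    (hC : 0 ≤ C) (hΩ : ∀ y ∈ ball y₀ r, HasFDerivAt Ω (DΩ y) y)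
    (hb : ∀ y ∈ ball y₀ r, ‖Ω y‖ ≤ C) (hDb : ∀ y ∈ ball y₀ r, ‖DΩ y‖ ≤ C)
    (hlip : ∀ y ∈ ball y₀ r, ∀ y' ∈ ball y₀ r, ‖DΩ y - DΩ y'‖ ≤ C * ‖y - y'‖)
    (hflat : ∀ y ∈ ball y₀ r, ∀ v w,
      DΩ y v w - DΩ y w v = Ω y v * Ω y w - Ω y w * Ω y v)
    {u : E → ℝ → 𝒜} (hu0 : ∀ y ∈ ball y₀ r, u y 0 = 1)
    (hu : ∀ y ∈ ball y₀ r, ∀ t ∈ Icc (0 : ℝ) 1,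
      HasDerivWithinAt (u y) (Ω (y₀ + t • (y - y₀)) (y - y₀) * u y t) (Icc 0 1) t)
    (huN : ∀ y ∈ ball y₀ r, ∀ t ∈ Icc (0 : ℝ) 1, ‖u y t‖ ≤ N)
    {y y' : E} (hy : y ∈ ball y₀ r) (hy' : y' ∈ ball y₀ r) :
    ‖u y' 1 - u y 1 - Ω y (y' - y) * u y 1‖ ≤
      gronwallBound 0 (C * r) 1 1
        * ((C * (r + 1) * (N + C * (2 * r) * N) + (C + C * r) * C * N) * ‖y' - y‖ ^ 2) := by
  set d := y - y₀ with hd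
  set z := y' - y with hz
  have hdz : y' - y₀ = d + z := by simp [hd, hz]
  have hr : 0 ≤ r := (norm_nonneg _).trans (mem_ball_iff_norm.1 hy).le
  have hdr : ‖d‖ ≤ r := (mem_ball_iff_norm.1 hy).le
  have hdzr : ‖d + z‖ ≤ r := hdz ▸ (mem_ball_iff_norm.1 hy').le
  have hzr : ‖z‖ ≤ 2 * r := by
    have : ‖z‖ ≤ ‖d + z‖ + ‖d‖ := by simpa using norm_sub_le (d + z) d
    linarith
  have hP : ∀ t ∈ Icc (0 : ℝ) 1, HasDerivWithinAt (fun t : ℝ => Ω (y₀ + t • d) (t • z))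
      (DΩ (y₀ + t • d) d (t • z) + Ω (y₀ + t • d) z) (Icc 0 1) t := fun t ht => by
    have h1 : HasDerivAt (fun t : ℝ => y₀ + t • d) d t := by
      simpa using ((hasDerivAt_id t).smul_const d).const_add y₀
    have h2 : HasDerivAt (fun t : ℝ => t • z) z t := by
      simpa using (hasDerivAt_id t).smul_const z
    have h3 : HasDerivAt (fun t : ℝ => Ω (y₀ + t • d)) (DΩ (y₀ + t • d) d) t :=
      (hΩ _ (add_smul_sub_mem_ball hy ht)).comp_hasDerivAt t h1
    exact (h3.clm_apply h2).hasDerivWithinAt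
  -- The function is the error of the first-order guess `(1 + Ω(t z)) u y` for `u y'`. It vanishes
  -- at `t = 0`, and at `t = 1` it is the quantity to be bounded.
  have key := norm_le_gronwallBound_mul
    (f := fun t => u y' t - (u y t + Ω (y₀ + t • d) (t • z) * u y t))
    (f' := fun t => Ω (y₀ + t • (d + z)) (d + z) * u y' t - (Ω (y₀ + t • d) d * u y t
      + ((DΩ (y₀ + t • d) d (t • z) + Ω (y₀ + t • d) z) * u y t
        + Ω (y₀ + t • d) (t • z) * (Ω (y₀ + t • d) d * u y t))))
    (K := C * r)
    (ε := (C * (r + 1) * (N + C * (2 * r) * N) + (C + C * r) * C * N) * ‖z‖ ^ 2)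
    (fun t ht => by
      have h1 := hu y' hy' t ht
      rw [hdz] at h1
      exact h1.sub ((hu y hy t ht).add ((hP t ht).mul (hu y hy t ht))))
    (by simp [hu0 y hy, hu0 y' hy'])
    (fun t ht => by
      have htn : ‖t • z‖ ≤ ‖z‖ := by
        rw [norm_smul, Real.norm_of_nonneg ht.1]
        exact mul_le_of_le_one_left (norm_nonneg _) ht.2
      have hPm := add_smul_sub_mem_ball hy ht
      have hPm' := add_smul_sub_mem_ball hy' ht
      rw [← hd] at hPm
      rw [hdz] at hPm'
      have hPP : y₀ + t • (d + z) - (y₀ + t • d) = t • z := by simp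
      have hT := norm_taylor_le (convex_ball y₀ r) hC hΩ hlip hPm hPm'
      have hL := (convex_ball y₀ r).norm_image_sub_le_of_norm_hasFDerivWithin_le
        (fun y hy => (hΩ y hy).hasFDerivWithinAt) hDb hPm hPm'
      rw [hPP] at hT hL
      rw [sq, ← mul_assoc] at hT
      exact norm_radial_deriv_le hC hr hdr hdzr hzr htn (hb _ hPm) (hDb _ hPm) (hb _ hPm')
        (huN y hy t ht) (hT.trans (by gcongr)) (hL.trans (by gcongr)) (hflat _ hPm (t • z) d))
  simp only [one_smul] at key
  have hyd' : y₀ + d = y := by simp [hd]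
  rw [hyd'] at key
  rwa [sub_sub]

/-- The endpoint of the radial solution of a flat linear system solves the system. -/
lemma hasFDerivAt_radial {Ω : E → E →L[ℝ] 𝒜} {DΩ : E → E →L[ℝ] E →L[ℝ] 𝒜} {y₀ : E} {r C N : ℝ}
    (hC : 0 ≤ C) (hΩ : ∀ y ∈ ball y₀ r, HasFDerivAt Ω (DΩ y) y)
    (hb : ∀ y ∈ ball y₀ r, ‖Ω y‖ ≤ C) (hDb : ∀ y ∈ ball y₀ r, ‖DΩ y‖ ≤ C)
    (hlip : ∀ y ∈ ball y₀ r, ∀ y' ∈ ball y₀ r, ‖DΩ y - DΩ y'‖ ≤ C * ‖y - y'‖)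
    (hflat : ∀ y ∈ ball y₀ r, ∀ v w,
      DΩ y v w - DΩ y w v = Ω y v * Ω y w - Ω y w * Ω y v)
    {u : E → ℝ → 𝒜} (hu0 : ∀ y ∈ ball y₀ r, u y 0 = 1)
    (hu : ∀ y ∈ ball y₀ r, ∀ t ∈ Icc (0 : ℝ) 1,
      HasDerivWithinAt (u y) (Ω (y₀ + t • (y - y₀)) (y - y₀) * u y t) (Icc 0 1) t)
    (huN : ∀ y ∈ ball y₀ r, ∀ t ∈ Icc (0 : ℝ) 1, ‖u y t‖ ≤ N)
    {y : E} (hy : y ∈ ball y₀ r) :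
    HasFDerivAt (fun y => u y 1)
      ((ContinuousLinearMap.mul ℝ 𝒜).flip (u y 1) ∘L Ω y) y := by
  rw [hasFDerivAt_iff_isLittleO]
  have hO : (fun y' => u y' 1 - u y 1
      - ((ContinuousLinearMap.mul ℝ 𝒜).flip (u y 1) ∘L Ω y) (y' - y))
        =O[nhds y] fun y' => ‖y' - y‖ ^ 2 := by
    refine Asymptotics.IsBigO.of_bound (gronwallBound 0 (C * r) 1 1
        * (C * (r + 1) * (N + C * (2 * r) * N) + (C + C * r) * C * N)) ?_
    filter_upwards [isOpen_ball.mem_nhds hy] with y' hy'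
    rw [Real.norm_of_nonneg (by positivity), mul_assoc]
    exact norm_radial_sub_le hC hΩ hb hDb hlip hflat hu0 hu huN hy hy'
  refine hO.trans_isLittleO ?_
  have h2 : (fun y' => y' - y) =o[nhds y] fun _ => (1 : ℝ) :=
    (Asymptotics.isLittleO_one_iff ℝ).2
      (by simpa using Filter.tendsto_id.sub (tendsto_const_nhds (x := y) (f := nhds y)))
  have h3 := h2.norm_left.mul_isBigO (Asymptotics.isBigO_refl (fun y' => ‖y' - y‖) (nhds y))
  simpa [sq] using h3.norm_right

/-- Existence of the radial solutions, near the centre. -/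
lemma exists_radial [CompleteSpace 𝒜] {Ω : E → E →L[ℝ] 𝒜} {y₀ : E} {r C : ℝ}
    (hC : 0 ≤ C) (hΩ : ContinuousOn Ω (ball y₀ r)) (hb : ∀ y ∈ ball y₀ r, ‖Ω y‖ ≤ C)
    (hr : C * r * (‖(1 : 𝒜)‖ + 1) ≤ 1) {y : E} (hy : y ∈ ball y₀ r) :
    ∃ u : ℝ → 𝒜, u 0 = 1 ∧ (∀ t ∈ Icc (0 : ℝ) 1,
      HasDerivWithinAt u (Ω (y₀ + t • (y - y₀)) (y - y₀) * u t) (Icc 0 1) t) ∧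
      ∀ t ∈ Icc (0 : ℝ) 1, ‖u t‖ ≤ ‖(1 : 𝒜)‖ + 1 := by
  have hdr : ‖y - y₀‖ ≤ r := (mem_ball_iff_norm.1 hy).le
  have hr0 : 0 ≤ r := (norm_nonneg _).trans hdr
  have hbd : ∀ t ∈ Icc (0 : ℝ) 1, ‖Ω (y₀ + t • (y - y₀)) (y - y₀)‖ ≤ C * r := fun t ht =>
    (ContinuousLinearMap.le_opNorm _ _).trans
      (mul_le_mul (hb _ (add_smul_sub_mem_ball hy ht)) hdr (norm_nonneg _) hC)
  have hball : ∀ x ∈ closedBall (1 : 𝒜) 1, ‖x‖ ≤ ‖(1 : 𝒜)‖ + 1 := fun x hx => by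
    have := norm_sub_norm_le x 1
    have h2 := mem_closedBall_iff_norm.1 hx
    linarith
  obtain ⟨K, hK⟩ : ∃ K : NNReal, (K : ℝ) = C * r := ⟨⟨C * r, by positivity⟩, rfl⟩
  rw [← hK] at hr hbd
  -- On the closed unit ball about `1` the speed is at most `C r (‖1‖ + 1) ≤ 1`, so a solution
  -- starting at `1` cannot leave that ball before time `1`.
  have hPL : IsPicardLindelof (fun t x => Ω (y₀ + t • (y - y₀)) (y - y₀) * x)
      (tmin := 0) (tmax := 1) ⟨0, by simp⟩ (1 : 𝒜) 1 0 1 K :=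
    { lipschitzOnWith := fun t ht => LipschitzOnWith.of_dist_le_mul fun x _ x' _ => by
        rw [dist_eq_norm, dist_eq_norm, ← mul_sub]
        exact (norm_mul_le _ _).trans (mul_le_mul_of_nonneg_right (hbd t ht) (norm_nonneg _))
      continuousOn := fun x _ => by
        have h1 : ContinuousOn (fun t : ℝ => Ω (y₀ + t • (y - y₀))) (Icc 0 1) :=
          hΩ.comp (by fun_prop) fun t ht => add_smul_sub_mem_ball hy ht
        exact (h1.clm_apply continuousOn_const).mul continuousOn_const
      norm_le := fun t ht x hx => (norm_mul_le _ _).trans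
        ((mul_le_mul (hbd t ht) (hball x (by simpa using hx)) (norm_nonneg _)
          K.2).trans (by simpa using hr))
      mul_max_le := by simp }
  -- The fixed point of the Picard operator is kept, rather than only a solution of the equation,
  -- because its values lie in the closed ball; this yields the bound on `‖u t‖`.
  obtain ⟨α, hα⟩ := ODE.FunSpace.exists_isFixedPt_next hPL (x := 1) (by simp)
  have h0 : α.compProj 0 = 1 := by
    rw [ODE.FunSpace.compProj_of_mem (by simp), ← hα]
    exact ODE.FunSpace.next_apply₀ hPL _ α
  refine ⟨α.compProj, h0, fun t ht => ?_, fun t _ => ?_⟩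
  · refine (ODE.hasDerivWithinAt_picard_Icc (t₀ := 0) (by simp) hPL.continuousOn_uncurry
      α.continuous_compProj.continuousOn (fun _ _ => α.compProj_mem_closedBall hPL.mul_max_le)
      1 ht).congr_of_mem (fun t' ht' => ?_) ht
    nth_rw 1 [← hα]
    rw [ODE.FunSpace.compProj_of_mem ht']
    exact ODE.FunSpace.next_apply hPL _ α
  · exact hball _ (by simpa using α.compProj_mem_closedBall hPL.mul_max_le (t := t))

end LocalSolution

/-! ### Local solvability of flat systems. -/

section LocalSolution

open Set Metric

variable {E : Type*} [NormedAddCommGroup E] [NormedSpace ℝ E]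
  {𝒜 : Type*} [NormedRing 𝒜] [NormedAlgebra ℝ 𝒜]

lemma eventually_norm_lt {X F : Type*} [TopologicalSpace X] [NormedAddCommGroup F] {f : X → F}
    {x : X} {C : ℝ} (hf : ContinuousAt f x) (h : ‖f x‖ < C) : ∀ᶠ y in nhds x, ‖f y‖ < C :=
  hf.norm.eventually (gt_mem_nhds h)

/-- Local solvability of the flat linear system `du = Ω u` with initial value `1`. -/
theorem exists_local_solution [CompleteSpace 𝒜] {Ω : E → E →L[ℝ] 𝒜} {U : Set E} (hU : IsOpen U)
    {y₀ : E} (hy₀ : y₀ ∈ U) (hΩ : ContDiffOn ℝ ∞ Ω U)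
    (hflat : ∀ y ∈ U, ∀ v w,
      fderiv ℝ Ω y v w - fderiv ℝ Ω y w v = Ω y v * Ω y w - Ω y w * Ω y v) :
    ∃ r > 0, ball y₀ r ⊆ U ∧ ∃ κ : E → 𝒜, κ y₀ = 1 ∧ ∀ y ∈ ball y₀ r,
      HasFDerivAt κ ((ContinuousLinearMap.mul ℝ 𝒜).flip (κ y) ∘L Ω y) y := by
  have hD : ContDiffOn ℝ ∞ (fderiv ℝ Ω) U := hΩ.fderiv_of_isOpen hU (by simp)
  obtain ⟨K, s, hs, hK⟩ :=
    ((hD.contDiffAt (hU.mem_nhds hy₀)).of_le (by simp : (1 : WithTop ℕ∞) ≤ ∞)).exists_lipschitzOnWith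
  -- One constant dominates the Lipschitz constant of the derivative and, strictly, both norms at
  -- `y₀`; strictness lets these bounds persist nearby.
  obtain ⟨C, hC0, hCK, hC1, hC2⟩ : ∃ C : ℝ, 0 ≤ C ∧ (K : ℝ) ≤ C ∧ ‖Ω y₀‖ < C ∧
      ‖fderiv ℝ Ω y₀‖ < C :=
    ⟨K + ‖Ω y₀‖ + ‖fderiv ℝ Ω y₀‖ + 1, by positivity,
      by linarith [norm_nonneg (Ω y₀), norm_nonneg (fderiv ℝ Ω y₀)],
      by linarith [K.2, norm_nonneg (fderiv ℝ Ω y₀)], by linarith [K.2, norm_nonneg (Ω y₀)]⟩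
  have hn1 : ∀ᶠ y in nhds y₀, ‖Ω y‖ < C :=
    eventually_norm_lt (hΩ.continuousOn.continuousAt (hU.mem_nhds hy₀)) hC1
  have hn2 : ∀ᶠ y in nhds y₀, ‖fderiv ℝ Ω y‖ < C :=
    eventually_norm_lt (F := E →L[ℝ] E →L[ℝ] 𝒜) (f := fderiv ℝ Ω)
      (hD.continuousOn.continuousAt (hU.mem_nhds hy₀)) hC2
  obtain ⟨ρ, hρ, hball⟩ := Metric.eventually_nhds_iff_ball.1
    (((hU.eventually_mem hy₀).and hs).and (hn1.and hn2))
  set m : ℝ := C * (‖(1 : 𝒜)‖ + 1) with hm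
  have hm0 : 0 ≤ m := by positivity
  -- The second bound gives `m r ≤ 1`, the smallness needed to reach time `1`; adding `1` to `m`
  -- keeps the denominator positive.
  let r := min ρ (1 / (m + 1))
  have hr0 : 0 < r := lt_min hρ (by positivity)
  have hsub : ball y₀ r ⊆ ball y₀ ρ := ball_subset_ball (min_le_left _ _)
  have hr1 : C * r * (‖(1 : 𝒜)‖ + 1) ≤ 1 := by
    calc C * r * (‖(1 : 𝒜)‖ + 1) = m * r := by rw [hm]; ring
      _ ≤ (m + 1) * (1 / (m + 1)) := by gcongr; exacts [by linarith, min_le_right _ _]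
      _ = 1 := by field_simp
  have hbU : ball y₀ r ⊆ U := fun y hy => (hball y (hsub hy)).1.1
  have hb : ∀ y ∈ ball y₀ r, ‖Ω y‖ ≤ C := fun y hy => (hball y (hsub hy)).2.1.le
  have hex := fun y (hy : y ∈ ball y₀ r) => exists_radial hC0 (hΩ.continuousOn.mono hbU) hb hr1 hy
  choose! u hu0 hu huN using hex
  refine ⟨r, hr0, hbU, fun y => u y 1, ?_, fun y hy => hasFDerivAt_radial hC0
    (fun y hy => ((hΩ.contDiffAt (hU.mem_nhds (hbU hy))).differentiableAt (by simp)).hasFDerivAt)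
    hb (fun y hy => (hball y (hsub hy)).2.2.le) (fun y hy y' hy' => ?_)
    (fun y hy => hflat y (hbU hy)) hu0 hu huN hy⟩
  -- The ray to the centre is constant, so its solution has zero derivative and stays at `1`.
  · have hy := mem_ball_self (x := y₀) hr0
    have h := norm_le_gronwallBound_mul (f := fun t => u y₀ t - 1) (K := 0) (ε := 0)
      (fun t ht => (hu y₀ hy t ht).sub_const 1) (by simp [hu0 y₀ hy]) (fun t ht => by simp)
    rw [mul_zero, norm_le_zero_iff, sub_eq_zero] at h
    exact h
  · have := hK.dist_le_mul y (hball y (hsub hy)).1.2 y' (hball y' (hsub hy')).1.2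
    rw [dist_eq_norm, dist_eq_norm] at this
    exact this.trans (by gcongr)

end LocalSolution

/-! ### Sections of coverings and locally constant cocycles. -/

section Covering

open Set Topology

/-- A covering of a locally path connected space with trivial fundamental groups has a section. -/
theorem exists_continuous_section {X Y : Type*} [TopologicalSpace X] [TopologicalSpace Y]
    [LocallyPathConnectedSpace X] (hX : ∀ x : X, Subsingleton (FundamentalGroup X x)) {p : Y → X}
    (cov : IsCoveringMap p) (hp : Function.Surjective p) :
    ∃ σ : X → Y, Continuous σ ∧ ∀ x, p (σ x) = x := by
  have hlift : ∀ x₀ : X, ∃ F : C(pathComponent x₀, Y), ∀ x, p (F x) = x := fun x₀ => by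
    obtain ⟨e₀, he₀⟩ := hp x₀
    have : PathConnectedSpace (pathComponent x₀) :=
      isPathConnected_iff_pathConnectedSpace.1 isPathConnected_pathComponent
    have : LocallyPathConnectedSpace (pathComponent x₀) :=
      (IsOpen.pathComponent x₀).locallyPathConnectedSpace
    -- The inclusion of the path component is lifted. The lifting criterion concerns loop classes in
    -- `X` at `x₀`, all of which are trivial.
    obtain ⟨F, ⟨-, hF⟩, -⟩ := cov.existsUnique_continuousMap_lifts_of_range_le
      (f := ⟨Subtype.val, continuous_subtype_val⟩)
      (a₀ := (⟨x₀, mem_pathComponent_self x₀⟩ : pathComponent x₀)) (e₀ := e₀) he₀ (by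
        rintro b -
        rw [(hX x₀).elim b 1]
        exact one_mem _)
    exact ⟨F, fun x => congrFun hF x⟩
  choose F hF using hlift
  -- `X` may be disconnected: `c` picks one base point in each path component. The components are
  -- open, so the lifts glue continuously.
  let c : X → X := fun x => Quotient.out (s := pathSetoid X) (Quotient.mk _ x)
  have hc : ∀ x, Joined (c x) x := fun x => Quotient.mk_out (s := pathSetoid X) x
  have hcc : ∀ x y, Joined x y → c x = c y := fun x y h =>
    congrArg (Quotient.out (s := pathSetoid X)) (Quotient.sound h)
  have key : ∀ {a b : X} (_ : a = b) {x : X} (ha : Joined a x) (hb : Joined b x),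
      F a ⟨x, ha⟩ = F b ⟨x, hb⟩ := by
    rintro a _ rfl x ha hb; rfl
  refine ⟨fun x => F (c x) ⟨x, hc x⟩, continuous_iff_continuousAt.2 fun x => ?_, fun x => hF _ _⟩
  have hO : IsOpen (pathComponent (c x)) := IsOpen.pathComponent _
  refine ContinuousOn.continuousAt (s := pathComponent (c x)) ?_ (hO.mem_nhds (hc x))
  rw [continuousOn_iff_continuous_domRestrict]
  refine (F (c x)).continuous.congr fun y => ?_
  have h : c y = c x := hcc _ _ (((hc x).symm.trans y.2).symm)
  exact key h.symm _ _

/-- A locally constant `1`-cocycle that is the coboundary of `κ` is the coboundary of a locally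
constant `0`-cochain, over a space with trivial fundamental groups. -/
theorem exists_locally_constant_correction {X : Type*} [TopologicalSpace X]
    [LocallyPathConnectedSpace X] (hX : ∀ x : X, Subsingleton (FundamentalGroup X x))
    {G : Type*} [Group G] (U : X → Set X) (hU : ∀ i, IsOpen (U i)) (hmem : ∀ x, x ∈ U x)
    (κ : X → X → G) (hκ : ∀ i j, ∀ x ∈ U i ∩ U j, ∀ᶠ y in 𝓝 x,
      (κ j y)⁻¹ * κ i y = (κ j x)⁻¹ * κ i x) :
    ∃ s : X → G, ∀ i, ∀ x ∈ U i, ∀ᶠ y in 𝓝 x, (κ i y)⁻¹ * s y = (κ i x)⁻¹ * s x := by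
  -- With the discrete topology on `G`, locally constant coordinate changes are continuous and the
  -- bundle is a covering.
  let _ : TopologicalSpace G := ⊥
  have : DiscreteTopology G := ⟨rfl⟩
  let Z : FiberBundleCore X X G :=
    { baseSet := U
      isOpen_baseSet := hU
      indexAt := id
      mem_baseSet_at := hmem
      coordChange := fun i j x g => (κ j x)⁻¹ * κ i x * g
      coordChange_self := by simp
      continuousOn_coordChange := fun i j => by
        rintro ⟨x, g⟩ ⟨hx, -⟩
        refine ContinuousAt.continuousWithinAt ?_
        refine (continuousAt_const (y := (κ j x)⁻¹ * κ i x)).mul continuousAt_snd |>.congr ?_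
        filter_upwards [continuousAt_fst.eventually (hκ i j x hx)] with y hy
        exact congrArg (· * y.2) hy.symm
      coordChange_comp := fun i j k x _ g => by group }
  obtain ⟨σ, hσ, hσ'⟩ := exists_continuous_section hX (p := Z.proj) FiberBundle.isCoveringMap
    fun x => ⟨⟨x, (1 : G)⟩, rfl⟩
  have hbase : ∀ x, (σ x).1 = x := hσ'
  -- In the trivialization with index `i` the section has coordinate `(κ i)⁻¹ * s`; continuity into
  -- a discrete space makes it locally constant.
  let s : X → G := fun x => κ x x * (show G from (σ x).2)
  have hs : ∀ i y, (Z.localTriv i (σ y)).2 = (κ i y)⁻¹ * s y := fun i y => by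
    rw [Z.localTriv_apply]
    change (κ i (σ y).1)⁻¹ * κ (σ y).1 (σ y).1 * _ = _
    rw [hbase]
    exact mul_assoc (G := G) _ _ _
  refine ⟨s, fun i x hx => ?_⟩
  have hx' : σ x ∈ (Z.localTriv i).source := by
    rw [(Z.localTriv i).mem_source, hσ']
    exact hx
  have h1 : ContinuousAt (fun y => (Z.localTriv i (σ y)).2) x :=
    (((Z.localTriv i).continuousAt hx').comp hσ.continuousAt).snd
  simp only [hs] at h1
  exact h1.eventually (IsOpen.mem_nhds (isOpen_discrete {_}) rfl)

end Covering

/-! ### Forms and exterior derivatives under change of chart. -/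

section ChartChange

open Set Topology

variable {E : Type*} [NormedAddCommGroup E] [NormedSpace ℝ E]
  {M : Type*} [TopologicalSpace M] [ChartedSpace E M]
  {F F' : Type*} [NormedAddCommGroup F] [NormedSpace ℝ F]
  [NormedAddCommGroup F'] [NormedSpace ℝ F']

/-- All tangent spaces are definitionally `E`; viewing the values there allows rewriting the base
point by `left_inv`. -/
lemma PreOneForm.congr_point (A : PreOneForm E M F) {x x' : M} (h : x = x') :
    (A x : E →L[ℝ] F) = A x' := by
  subst h; rfl

lemma localOne_apply_mfderiv [IsManifold 𝓘(ℝ, E) 1 M] (A : PreOneForm E M F)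
    {φ : OpenPartialHomeomorph M E} (hφ : φ ∈ atlas E M) {x : M} (hx : x ∈ φ.source)
    (v : TangentSpace 𝓘(ℝ, E) x) :
    localOne φ A (φ x) (mfderiv 𝓘(ℝ, E) 𝓘(ℝ, E) φ x v) = A x v := by
  have h := (mdifferentiable_of_mem_atlas (I := 𝓘(ℝ, E)) hφ).symm_comp_deriv hx
  have h2 : mfderiv 𝓘(ℝ, E) 𝓘(ℝ, E) φ.symm (φ x) (mfderiv 𝓘(ℝ, E) 𝓘(ℝ, E) φ x v) = v :=
    congrArg (fun L : E →L[ℝ] E => L v) h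
  have h3 : (A (φ.symm (φ x)) : E →L[ℝ] F) = A x := A.congr_point (φ.left_inv hx)
  calc _ = (A (φ.symm (φ x)) : E →L[ℝ] F) (mfderiv 𝓘(ℝ, E) 𝓘(ℝ, E) φ.symm (φ x)
        (mfderiv 𝓘(ℝ, E) 𝓘(ℝ, E) φ x v)) := rfl
    _ = _ := by rw [h2, h3]; rfl

lemma mfderiv_apply_mfderiv_symm [IsManifold 𝓘(ℝ, E) 1 M] {φ : OpenPartialHomeomorph M E}
    (hφ : φ ∈ atlas E M) {y : E} (hy : y ∈ φ.target) (v : E) :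
    (mfderiv 𝓘(ℝ, E) 𝓘(ℝ, E) φ (φ.symm y) (mfderiv 𝓘(ℝ, E) 𝓘(ℝ, E) φ.symm y v) : E) = v :=
  congrArg (fun L : E →L[ℝ] E => L v)
    ((mdifferentiable_of_mem_atlas (I := 𝓘(ℝ, E)) hφ).comp_symm_deriv hy)

lemma HasMFDerivAt.comp_chart_symm [IsManifold 𝓘(ℝ, E) 1 M] {f : M → F}
    {φ : OpenPartialHomeomorph M E} (hφ : φ ∈ atlas E M) {y : E} (hy : y ∈ φ.target)
    {L : E →L[ℝ] F} (hf : HasMFDerivAt 𝓘(ℝ, E) 𝓘(ℝ, F) f (φ.symm y) L) :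
    HasFDerivAt (f ∘ φ.symm) (L ∘L (mfderiv 𝓘(ℝ, E) 𝓘(ℝ, E) φ.symm y : E →L[ℝ] E)) y :=
  (hf.comp y (mdifferentiableAt_atlas_symm hφ hy).hasMFDerivAt).hasFDerivAt

lemma hasMFDerivAt_comp_chart [IsManifold 𝓘(ℝ, E) 1 M] {κ : E → F}
    {φ : OpenPartialHomeomorph M E} (hφ : φ ∈ atlas E M) {x : M} (hx : x ∈ φ.source)
    {L : E →L[ℝ] F} (hκ : HasFDerivAt κ L (φ x)) :
    HasMFDerivAt 𝓘(ℝ, E) 𝓘(ℝ, F) (κ ∘ φ) x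
      (L ∘L (mfderiv 𝓘(ℝ, E) 𝓘(ℝ, E) φ x : E →L[ℝ] E)) :=
  HasMFDerivAt.comp x (I' := 𝓘(ℝ, E)) (g' := L) hκ.hasMFDerivAt
    (mdifferentiableAt_atlas hφ hx).hasMFDerivAt

lemma contDiffAt_transition [IsManifold 𝓘(ℝ, E) ∞ M] {φ ψ : OpenPartialHomeomorph M E}
    (hφ : φ ∈ atlas E M) (hψ : ψ ∈ atlas E M) {y : E} (hy : y ∈ φ.target)
    (hy' : φ.symm y ∈ ψ.source) : ContDiffAt ℝ ∞ (ψ ∘ φ.symm) y := by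
  have h1 : ContMDiffAt 𝓘(ℝ, E) 𝓘(ℝ, E) ∞ φ.symm y :=
    (contMDiffOn_symm_of_mem_maximalAtlas (IsManifold.subset_maximalAtlas hφ)).contMDiffAt
      (φ.open_target.mem_nhds hy)
  have h2 : ContMDiffAt 𝓘(ℝ, E) 𝓘(ℝ, E) ∞ ψ (φ.symm y) :=
    (contMDiffOn_of_mem_maximalAtlas (IsManifold.subset_maximalAtlas hψ)).contMDiffAt
      (ψ.open_source.mem_nhds hy')
  exact (h2.comp y h1).contDiffAt

lemma eventually_mem_transition {X Y : Type*} [TopologicalSpace X] [TopologicalSpace Y]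
    {φ ψ : OpenPartialHomeomorph X Y} {y : Y} (hy : y ∈ φ.target)
    (hy' : φ.symm y ∈ ψ.source) : ∀ᶠ z in 𝓝 y, z ∈ φ.target ∧ φ.symm z ∈ ψ.source :=
  (φ.open_target.eventually_mem hy).and
    ((φ.continuousAt_symm hy).eventually (ψ.open_source.mem_nhds hy'))

/-- Near `y`, `φ.symm` is `ψ.symm` after the transition map; the chain rule gives the pullback law.
-/
lemma localOne_transition [IsManifold 𝓘(ℝ, E) ∞ M] (A : PreOneForm E M F)
    {φ ψ : OpenPartialHomeomorph M E} (hφ : φ ∈ atlas E M) (hψ : ψ ∈ atlas E M) {y : E}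
    (hy : y ∈ φ.target) (hy' : φ.symm y ∈ ψ.source) :
    localOne φ A y = localOne ψ A (ψ (φ.symm y)) ∘L fderiv ℝ (ψ ∘ φ.symm) y := by
  have : IsManifold 𝓘(ℝ, E) 1 M := .of_le (n := ∞) (by simp)
  have hτ := ((contDiffAt_transition hφ hψ hy hy').differentiableAt (by simp)).hasFDerivAt
  have hψ' : ψ (φ.symm y) ∈ ψ.target := ψ.map_source hy'
  have h1 : HasMFDerivAt 𝓘(ℝ, E) 𝓘(ℝ, E) (ψ.symm ∘ (ψ ∘ φ.symm)) y
      ((mfderiv 𝓘(ℝ, E) 𝓘(ℝ, E) ψ.symm (ψ (φ.symm y)) : E →L[ℝ] E)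
        ∘L fderiv ℝ (ψ ∘ φ.symm) y) :=
    HasMFDerivAt.comp y (I' := 𝓘(ℝ, E)) (g := ψ.symm) (f := ψ ∘ φ.symm)
      (mdifferentiableAt_atlas_symm hψ hψ').hasMFDerivAt hτ.hasMFDerivAt
  have h2 : ψ.symm ∘ (ψ ∘ φ.symm) =ᶠ[𝓝 y] φ.symm := by
    filter_upwards [eventually_mem_transition hy hy'] with z hz
    exact ψ.left_inv hz.2
  have h3 : (mfderiv 𝓘(ℝ, E) 𝓘(ℝ, E) φ.symm y : E →L[ℝ] E)
      = (mfderiv 𝓘(ℝ, E) 𝓘(ℝ, E) ψ.symm (ψ (φ.symm y)) : E →L[ℝ] E)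
        ∘L fderiv ℝ (ψ ∘ φ.symm) y :=
    (h1.congr_of_eventuallyEq h2.symm).mfderiv
  have h4 : (A (ψ.symm (ψ (φ.symm y))) : E →L[ℝ] F) = A (φ.symm y) := A.congr_point (ψ.left_inv hy')
  have h5 : localOne φ A y = (A (φ.symm y) : E →L[ℝ] F)
      ∘L (mfderiv 𝓘(ℝ, E) 𝓘(ℝ, E) φ.symm y : E →L[ℝ] E) := rfl
  rw [h5, h3, ← h4]
  rfl

lemma fderiv_transition_mfderiv [IsManifold 𝓘(ℝ, E) ∞ M]
    {φ ψ : OpenPartialHomeomorph M E} (hφ : φ ∈ atlas E M) (hψ : ψ ∈ atlas E M) {x : M}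
    (hx : x ∈ φ.source) (hx' : x ∈ ψ.source) (v : TangentSpace 𝓘(ℝ, E) x) :
    fderiv ℝ (ψ ∘ φ.symm) (φ x) (mfderiv 𝓘(ℝ, E) 𝓘(ℝ, E) φ x v)
      = mfderiv 𝓘(ℝ, E) 𝓘(ℝ, E) ψ x v := by
  have : IsManifold 𝓘(ℝ, E) 1 M := .of_le (n := ∞) (by simp)
  have hx'' : φ.symm (φ x) ∈ ψ.source := by rwa [φ.left_inv hx]
  have hτ := ((contDiffAt_transition hφ hψ (φ.map_source hx) hx'').differentiableAt
    (by simp)).hasFDerivAt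
  have h1 := hasMFDerivAt_comp_chart hφ hx hτ
  have h2 : (ψ ∘ φ.symm) ∘ φ =ᶠ[𝓝 x] ψ := by
    filter_upwards [φ.open_source.mem_nhds hx] with z hz
    simp [φ.left_inv hz]
  have h3 := (h1.congr_of_eventuallyEq h2.symm).mfderiv
  exact congrArg (fun L : E →L[ℝ] E => L v) h3.symm

/-- The exterior derivative can be computed in any chart. -/
theorem extDer_eq [IsManifold 𝓘(ℝ, E) ∞ M] (A : OneForm E M F)
    {φ : OpenPartialHomeomorph M E} (hφ : φ ∈ atlas E M) {x : M} (hx : x ∈ φ.source)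
    (v w : TangentSpace 𝓘(ℝ, E) x) :
    extDer A x v w = fderiv ℝ (localOne φ A.toFun) (φ x) (mfderiv 𝓘(ℝ, E) 𝓘(ℝ, E) φ x v)
        (mfderiv 𝓘(ℝ, E) 𝓘(ℝ, E) φ x w)
      - fderiv ℝ (localOne φ A.toFun) (φ x) (mfderiv 𝓘(ℝ, E) 𝓘(ℝ, E) φ x w)
        (mfderiv 𝓘(ℝ, E) 𝓘(ℝ, E) φ x v) := by
  set ψ := chartAt E x with hψdef
  have hψ : ψ ∈ atlas E M := chart_mem_atlas E x
  have hx' : x ∈ ψ.source := mem_chart_source E x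
  have hy : φ x ∈ φ.target := φ.map_source hx
  have hy' : φ.symm (φ x) ∈ ψ.source := by rwa [φ.left_inv hx]
  have hτ := contDiffAt_transition hφ hψ hy hy'
  have hev : localOne φ A.toFun =ᶠ[𝓝 (φ x)] fun z =>
      localOne ψ A.toFun ((ψ ∘ φ.symm) z) ∘L fderiv ℝ (ψ ∘ φ.symm) z := by
    filter_upwards [eventually_mem_transition hy hy'] with z hz
    exact localOne_transition A.toFun hφ hψ hz.1 hz.2
  have hτx : (ψ ∘ φ.symm) (φ x) = ψ x := by simp [φ.left_inv hx]
  have hA : HasFDerivAt (localOne ψ A.toFun) (fderiv ℝ (localOne ψ A.toFun) (ψ x))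
      ((ψ ∘ φ.symm) (φ x)) := by
    rw [hτx]
    exact (((A.smooth ψ hψ).contDiffAt (ψ.open_target.mem_nhds (ψ.map_source hx'))).differentiableAt
      (by simp)).hasFDerivAt
  have hτ1 := (hτ.differentiableAt (by simp)).hasFDerivAt
  have hτ2 := ((hτ.fderiv_right (m := ∞) (by simp)).differentiableAt (by simp)).hasFDerivAt
  have hder := ((hA.comp (φ x) hτ1).clm_comp hτ2).congr_of_eventuallyEq hev
  -- The only term that is not the pullback contains the second derivative of the transition map; it
  -- is symmetric and drops out on antisymmetrizing.
  have hsymm : IsSymmSndFDerivAt ℝ (ψ ∘ φ.symm) (φ x) := hτ.isSymmSndFDerivAt (by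
    rw [minSmoothness_of_isRCLikeNormedField]; exact WithTop.coe_le_coe.2 (le_top : (2 : ℕ∞) ≤ ⊤))
  rw [hder.fderiv]
  have hv := fderiv_transition_mfderiv hφ hψ hx hx' v
  have hw := fderiv_transition_mfderiv hφ hψ hx hx' w
  have hs := hsymm (mfderiv 𝓘(ℝ, E) 𝓘(ℝ, E) φ x v) (mfderiv 𝓘(ℝ, E) 𝓘(ℝ, E) φ x w)
  change fderiv ℝ (localOne ψ A.toFun) (ψ x) (mfderiv 𝓘(ℝ, E) 𝓘(ℝ, E) ψ x v)
      (mfderiv 𝓘(ℝ, E) 𝓘(ℝ, E) ψ x w)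
    - fderiv ℝ (localOne ψ A.toFun) (ψ x) (mfderiv 𝓘(ℝ, E) 𝓘(ℝ, E) ψ x w)
      (mfderiv 𝓘(ℝ, E) 𝓘(ℝ, E) ψ x v) = _
  rw [← hv, ← hw]
  generalize (mfderiv 𝓘(ℝ, E) 𝓘(ℝ, E) φ x v : E) = v' at *
  generalize (mfderiv 𝓘(ℝ, E) 𝓘(ℝ, E) φ x w : E) = w' at *
  change _ = (localOne ψ A.toFun ((ψ ∘ φ.symm) (φ x))
      (fderiv ℝ (fderiv ℝ (ψ ∘ φ.symm)) (φ x) v' w')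
      + fderiv ℝ (localOne ψ A.toFun) (ψ x) (fderiv ℝ (ψ ∘ φ.symm) (φ x) v')
        (fderiv ℝ (ψ ∘ φ.symm) (φ x) w'))
    - (localOne ψ A.toFun ((ψ ∘ φ.symm) (φ x))
      (fderiv ℝ (fderiv ℝ (ψ ∘ φ.symm)) (φ x) w' v')
      + fderiv ℝ (localOne ψ A.toFun) (ψ x) (fderiv ℝ (ψ ∘ φ.symm) (φ x) w')
        (fderiv ℝ (ψ ∘ φ.symm) (φ x) v'))
  rw [hs]
  abel

/-- The composition of a 1-form with a continuous linear map of the values. -/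
def OneForm.postcomp (ℓ : F →L[ℝ] F') (A : OneForm E M F) : OneForm E M F' where
  toFun x := ℓ ∘L (A.toFun x)
  smooth φ hφ := (ContDiff.comp_contDiffOn (f := localOne φ A.toFun)
    (ContinuousLinearMap.compL ℝ E F F' ℓ).contDiff (A.smooth φ hφ))

lemma extDer_postcomp [IsManifold 𝓘(ℝ, E) ∞ M] (ℓ : F →L[ℝ] F') (A : OneForm E M F) (x : M)
    (v w : TangentSpace 𝓘(ℝ, E) x) : extDer (A.postcomp ℓ) x v w = ℓ (extDer A x v w) := by
  have hA := (((A.smooth _ (chart_mem_atlas E x)).contDiffAt ((chartAt E x).open_target.mem_nhds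
    ((chartAt E x).map_source (mem_chart_source E x)))).differentiableAt (by simp)).hasFDerivAt
  have h : HasFDerivAt (localOne (chartAt E x) (A.postcomp ℓ).toFun) _ (chartAt E x x) :=
    (ContinuousLinearMap.compL ℝ E F F' ℓ).hasFDerivAt.comp _ hA
  rw [extDer_eq _ (chart_mem_atlas E x) (mem_chart_source E x),
    extDer_eq _ (chart_mem_atlas E x) (mem_chart_source E x), h.fderiv, map_sub]
  rfl

/-- A flat 1-form is flat in every chart. -/
lemma flat_localOne {𝒜 : Type*} [NormedRing 𝒜] [NormedAlgebra ℝ 𝒜] [IsManifold 𝓘(ℝ, E) ∞ M]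
    {A : OneForm E M 𝒜} (hA : ∀ (x : M) (v w : TangentSpace 𝓘(ℝ, E) x),
      extDer A x v w + (A.toFun x v * A.toFun x w - A.toFun x w * A.toFun x v) = 0)
    {φ : OpenPartialHomeomorph M E} (hφ : φ ∈ atlas E M) {y : E} (hy : y ∈ φ.target) (v w : E) :
    fderiv ℝ (localOne φ A.toFun) y v w - fderiv ℝ (localOne φ A.toFun) y w v
      + (localOne φ A.toFun y v * localOne φ A.toFun y w
        - localOne φ A.toFun y w * localOne φ A.toFun y v) = 0 := by
  have : IsManifold 𝓘(ℝ, E) 1 M := .of_le (n := ∞) (by simp)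
  have hx : φ.symm y ∈ φ.source := φ.map_target hy
  have h := hA (φ.symm y) (mfderiv 𝓘(ℝ, E) 𝓘(ℝ, E) φ.symm y v)
    (mfderiv 𝓘(ℝ, E) 𝓘(ℝ, E) φ.symm y w)
  rw [extDer_eq A hφ hx, mfderiv_apply_mfderiv_symm hφ hy, mfderiv_apply_mfderiv_symm hφ hy,
    φ.right_inv hy] at h
  exact h

end ChartChange

/-! ### The equation `dκ = -A κ` on a manifold. -/

section Parallel

open Set Topology Metric

variable {E : Type*} [NormedAddCommGroup E] [NormedSpace ℝ E]
  {M : Type*} [TopologicalSpace M] [ChartedSpace E M]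
  {F : Type*} [NormedAddCommGroup F] [NormedSpace ℝ F]
  {𝒜 : Type*} [NormedRing 𝒜] [NormedAlgebra ℝ 𝒜]

/-- A function whose derivative vanishes near a point is constant near that point. -/
lemma eventually_eq_of_hasMFDerivAt_zero [IsManifold 𝓘(ℝ, E) 1 M] {f : M → F} {x : M}
    (hf : ∀ᶠ y in 𝓝 x, HasMFDerivAt 𝓘(ℝ, E) 𝓘(ℝ, F) f y (0 : E →L[ℝ] F)) :
    ∀ᶠ y in 𝓝 x, f y = f x := by
  set φ := chartAt E x
  have hφ : φ ∈ atlas E M := chart_mem_atlas E x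
  have hx : x ∈ φ.source := mem_chart_source E x
  have hx' := φ.map_source hx
  have h1 : ∀ᶠ y in 𝓝 (φ x), y ∈ φ.target ∧
      HasMFDerivAt 𝓘(ℝ, E) 𝓘(ℝ, F) f (φ.symm y) (0 : E →L[ℝ] F) := by
    refine (φ.open_target.eventually_mem hx').and ?_
    rw [← φ.left_inv hx] at hf
    exact (φ.continuousAt_symm hx').eventually hf
  obtain ⟨r, hr, hball⟩ := Metric.eventually_nhds_iff_ball.1 h1
  have h2 : ∀ y ∈ ball (φ x) r, HasFDerivAt (f ∘ φ.symm) (0 : E →L[ℝ] F) y := fun y hy =>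
    (HasMFDerivAt.comp_chart_symm hφ (hball y hy).1 (hball y hy).2).congr_fderiv
      (ContinuousLinearMap.zero_comp _)
  filter_upwards [φ.open_source.mem_nhds hx, (φ.continuousAt hx).eventually (ball_mem_nhds _ hr)]
    with y hy hy'
  have h3 := isOpen_ball.is_const_of_fderiv_eq_zero (𝕜 := ℝ) (convex_ball (φ x) r).isPreconnected
    (fun z hz => (h2 z hz).differentiableAt.differentiableWithinAt) (fun z hz => (h2 z hz).fderiv)
    hy' (mem_ball_self hr)
  simpa [φ.left_inv hy, φ.left_inv hx] using h3

/-- Bootstrapping: a solution of a first order system with smooth right hand side is smooth. -/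
lemma contDiffOn_of_hasFDerivAt_eq {U : Set E} (hU : IsOpen U) {G : E × F → E →L[ℝ] F}
    (hG : ContDiffOn ℝ ∞ G (U ×ˢ univ)) {f : E → F}
    (hf : ∀ y ∈ U, HasFDerivAt f (G (y, f y)) y) : ContDiffOn ℝ ∞ f U := by
  have hd : DifferentiableOn ℝ f U := fun y hy => (hf y hy).differentiableAt.differentiableWithinAt
  rw [contDiffOn_infty]
  intro n
  induction n with
  | zero => exact contDiffOn_zero.2 hd.continuousOn
  | succ n ih =>
    rw [Nat.cast_succ, contDiffOn_succ_iff_fderiv_of_isOpen hU]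
    refine ⟨hd, by simp, ?_⟩
    have h1 : ContDiffOn ℝ n (fun y => G (y, f y)) U :=
      (hG.of_le (by exact mod_cast le_top)).comp (contDiffOn_id.prodMk ih) fun y hy => ⟨hy, trivial⟩
    exact h1.congr fun y hy => (hf y hy).fderiv

lemma contMDiff_of_contDiffOn_charts [IsManifold 𝓘(ℝ, E) ∞ M] {f : M → F}
    (hf : ∀ φ ∈ atlas E M, ContDiffOn ℝ ∞ (f ∘ φ.symm) φ.target) :
    ContMDiff 𝓘(ℝ, E) 𝓘(ℝ, F) ∞ f := fun x => by
  have hx := mem_chart_source E x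
  have h1 := ((hf _ (chart_mem_atlas E x)).contDiffAt
    ((chartAt E x).open_target.mem_nhds ((chartAt E x).map_source hx))).contMDiffAt
  have h2 : ContMDiffAt 𝓘(ℝ, E) 𝓘(ℝ, E) ∞ (chartAt E x) x :=
    (contMDiffOn_of_mem_maximalAtlas
      (IsManifold.subset_maximalAtlas (chart_mem_atlas E x))).contMDiffAt
      ((chartAt E x).open_source.mem_nhds hx)
  refine (h1.comp x h2).congr_of_eventuallyEq ?_
  filter_upwards [(chartAt E x).open_source.mem_nhds hx] with y hy
  simp [(chartAt E x).left_inv hy]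

/-- `κ` solves `dκ = - A κ` at the point `x`. -/
def IsParallelAt (A : OneForm E M 𝒜) (κ : M → 𝒜ˣ) (x : M) : Prop :=
  HasMFDerivAt 𝓘(ℝ, E) 𝓘(ℝ, 𝒜) (fun y => (κ y : 𝒜)) x
    (-((ContinuousLinearMap.mul ℝ 𝒜).flip (κ x) ∘L (A.toFun x : E →L[ℝ] 𝒜)))

lemma HasMFDerivAt.mul_apply {f g : M → 𝒜} {x : M} {f' g' L : E →L[ℝ] 𝒜}
    (hf : HasMFDerivAt 𝓘(ℝ, E) 𝓘(ℝ, 𝒜) f x f') (hg : HasMFDerivAt 𝓘(ℝ, E) 𝓘(ℝ, 𝒜) g x g')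
    (hL : ∀ v, L v = f x * g' v + f' v * g x) :
    HasMFDerivAt 𝓘(ℝ, E) 𝓘(ℝ, 𝒜) (fun y => f y * g y) x L :=
  (hf.mul' hg).congr_mfderiv (ContinuousLinearMap.ext fun v => (hL v).symm)

lemma IsParallelAt.inv [CompleteSpace 𝒜] {A : OneForm E M 𝒜} {κ : M → 𝒜ˣ} {x : M}
    (h : IsParallelAt A κ x) :
    HasMFDerivAt 𝓘(ℝ, E) 𝓘(ℝ, 𝒜) (fun y => (((κ y)⁻¹ : 𝒜ˣ) : 𝒜)) x
      (ContinuousLinearMap.mul ℝ 𝒜 ((κ x)⁻¹ : 𝒜ˣ) ∘L (A.toFun x : E →L[ℝ] 𝒜)) := by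
  have h1 := (HasMFDerivAt.comp x (I' := 𝓘(ℝ, 𝒜)) (g := Ring.inverse)
    (hasFDerivAt_ringInverse (𝕜 := ℝ) (κ x)).hasMFDerivAt h)
  have h2 : (Ring.inverse ∘ fun y => (κ y : 𝒜)) = fun y => (((κ y)⁻¹ : 𝒜ˣ) : 𝒜) :=
    funext fun y => Ring.inverse_unit _
  rw [h2] at h1
  refine h1.congr_mfderiv (ContinuousLinearMap.ext fun v => ?_)
  change -((((κ x)⁻¹ : 𝒜ˣ) : 𝒜) * -((A.toFun x : E →L[ℝ] 𝒜) v * κ x) * (((κ x)⁻¹ : 𝒜ˣ) : 𝒜))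
    = (((κ x)⁻¹ : 𝒜ˣ) : 𝒜) * (A.toFun x : E →L[ℝ] 𝒜) v
  rw [mul_neg, neg_mul, neg_neg, ← mul_assoc, Units.mul_inv_cancel_right]

/-- For `h = κ' κ⁻¹` this is `dh = h A - A' h`, the infinitesimal form of the statement that `h`
carries `A` to `A'`. -/
lemma IsParallelAt.mul_inv [CompleteSpace 𝒜] {A A' : OneForm E M 𝒜} {κ κ' : M → 𝒜ˣ} {x : M}
    (h : IsParallelAt A κ x) (h' : IsParallelAt A' κ' x) :
    HasMFDerivAt 𝓘(ℝ, E) 𝓘(ℝ, 𝒜) (fun y => ((κ' y * (κ y)⁻¹ : 𝒜ˣ) : 𝒜)) x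
      (ContinuousLinearMap.mul ℝ 𝒜 (κ' x * (κ x)⁻¹ : 𝒜ˣ) ∘L (A.toFun x : E →L[ℝ] 𝒜)
        - (ContinuousLinearMap.mul ℝ 𝒜).flip (κ' x * (κ x)⁻¹ : 𝒜ˣ)
          ∘L (A'.toFun x : E →L[ℝ] 𝒜)) := by
  refine HasMFDerivAt.mul_apply h' h.inv fun v => ?_
  change ((κ' x * (κ x)⁻¹ : 𝒜ˣ) : 𝒜) * (A.toFun x : E →L[ℝ] 𝒜) v
      - (A'.toFun x : E →L[ℝ] 𝒜) v * ((κ' x * (κ x)⁻¹ : 𝒜ˣ) : 𝒜)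
    = (κ' x : 𝒜) * ((((κ x)⁻¹ : 𝒜ˣ) : 𝒜) * (A.toFun x : E →L[ℝ] 𝒜) v)
      + -((A'.toFun x : E →L[ℝ] 𝒜) v * κ' x) * (((κ x)⁻¹ : 𝒜ˣ) : 𝒜)
  simp only [Units.val_mul, mul_assoc, neg_mul, sub_eq_add_neg]

/-- The two contributions of `A` cancel. Hence solutions for the same `A` differ by a locally
constant right factor. -/
lemma IsParallelAt.inv_mul [CompleteSpace 𝒜] {A : OneForm E M 𝒜} {κ κ' : M → 𝒜ˣ} {x : M}
    (h : IsParallelAt A κ x) (h' : IsParallelAt A κ' x) :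
    HasMFDerivAt 𝓘(ℝ, E) 𝓘(ℝ, 𝒜) (fun y => (((κ' y)⁻¹ * κ y : 𝒜ˣ) : 𝒜)) x (0 : E →L[ℝ] 𝒜) := by
  refine HasMFDerivAt.mul_apply h'.inv h fun v => ?_
  change 0 = (((κ' x)⁻¹ : 𝒜ˣ) : 𝒜) * -((A.toFun x : E →L[ℝ] 𝒜) v * κ x)
      + (((κ' x)⁻¹ : 𝒜ˣ) : 𝒜) * (A.toFun x : E →L[ℝ] 𝒜) v * κ x
  rw [mul_neg, mul_assoc, neg_add_cancel]

/-- `A` acts from the left, so constant right factors are harmless; the global correction uses this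
freedom. -/
lemma IsParallelAt.mul_const {A : OneForm E M 𝒜} {κ : M → 𝒜ˣ} {x : M}
    (h : IsParallelAt A κ x) (c : 𝒜ˣ) : IsParallelAt A (fun y => κ y * c) x := by
  refine HasMFDerivAt.mul_apply h (hasMFDerivAt_const (c : 𝒜) x) fun v => ?_
  change -((A.toFun x : E →L[ℝ] 𝒜) v * ((κ x * c : 𝒜ˣ) : 𝒜))
    = κ x * (0 : 𝒜) + -((A.toFun x : E →L[ℝ] 𝒜) v * κ x) * c
  rw [mul_zero, zero_add, Units.val_mul, neg_mul, mul_assoc]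

lemma IsParallelAt.congr {A : OneForm E M 𝒜} {κ κ' : M → 𝒜ˣ} {x : M}
    (h : IsParallelAt A κ x) (h' : κ' =ᶠ[𝓝 x] κ) : IsParallelAt A κ' x := by
  unfold IsParallelAt
  rw [h'.eq_of_nhds]
  exact h.congr_of_eventuallyEq (h'.mono fun y hy => congrArg Units.val hy)

/-- For `Ω = -l`, flatness of `l` becomes the integrability condition of `dκ = Ω κ`. -/
lemma neg_sub_neg_eq_of_flat {R : Type*} [Ring R] {a b c d : R}
    (h : a - b + (c * d - d * c) = 0) : -a - -b = -c * -d - -d * -c := by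
  rw [neg_mul_neg, neg_mul_neg, eq_neg_of_add_eq_zero_right h]
  abel

/-- Local solvability of `dκ = - l κ` for a flat connection `l`. -/
lemma exists_local_solution_neg [CompleteSpace 𝒜] {l : E → E →L[ℝ] 𝒜} {U : Set E} (hU : IsOpen U)
    {y₀ : E} (hy₀ : y₀ ∈ U) (hl : ContDiffOn ℝ ∞ l U)
    (hflat : ∀ y ∈ U, ∀ v w, fderiv ℝ l y v w - fderiv ℝ l y w v
      + (l y v * l y w - l y w * l y v) = 0) :
    ∃ r > 0, ∃ κ : E → 𝒜, κ y₀ = 1 ∧ ∀ y ∈ ball y₀ r,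
      HasFDerivAt κ ((ContinuousLinearMap.mul ℝ 𝒜).flip (κ y) ∘L (-l y)) y := by
  have hfd : ∀ y, fderiv ℝ (fun y => -l y) y = -fderiv ℝ l y := fun y => fderiv_fun_neg
  obtain ⟨r, hr, -, h⟩ := exists_local_solution (Ω := fun y => -l y) hU hy₀ hl.neg
    fun y hy v w => by
      rw [hfd]
      exact neg_sub_neg_eq_of_flat (hflat y hy v w)
  exact ⟨r, hr, h⟩

lemma isParallelAt_of_chart [IsManifold 𝓘(ℝ, E) 1 M] {A : OneForm E M 𝒜}
    {φ : OpenPartialHomeomorph M E} (hφ : φ ∈ atlas E M) {x : M} (hx : x ∈ φ.source) {κ : E → 𝒜}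
    (hκ : HasFDerivAt κ ((ContinuousLinearMap.mul ℝ 𝒜).flip (κ (φ x))
      ∘L (-localOne φ A.toFun (φ x))) (φ x))
    {k : M → 𝒜ˣ} (hk : (fun y => (k y : 𝒜)) =ᶠ[𝓝 x] κ ∘ φ) : IsParallelAt A k x := by
  have h1 := hasMFDerivAt_comp_chart hφ hx hκ
  refine (h1.congr_of_eventuallyEq hk).congr_mfderiv (ContinuousLinearMap.ext fun v => ?_)
  have h3 := localOne_apply_mfderiv A.toFun hφ hx v
  have h4 : (k x : 𝒜) = κ (φ x) := hk.eq_of_nhds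
  change -localOne φ A.toFun (φ x) (mfderiv 𝓘(ℝ, E) 𝓘(ℝ, E) φ x v) * κ (φ x)
    = -(A.toFun x v * (k x : 𝒜))
  rw [h3, h4, neg_mul]

end Parallel

/-! ### Parallel functions with values in `O(p,q)`. -/

section Lorentz

open Set Topology Metric

variable {p q : ℕ}

lemma eq_zero_of_eta_eq_zero {z : Rpq p q} (h : ∀ b, eta z b = 0) : z = 0 := by
  funext i
  rcases i with i | j
  · simpa [eta, Pi.single_apply] using h (Pi.single (Sum.inl i) 1)
  · simpa [eta, Pi.single_apply] using h (Pi.single (Sum.inr j) 1)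

/-- Nondegeneracy of `eta` makes `X` injective, hence invertible in finite dimension. -/
lemma exists_lorentz_eq {X : EndR p q} (hX : ∀ a b, eta (X a) (X b) = eta a b) :
    ∃ h : lorentz p q, ((h : (EndR p q)ˣ) : EndR p q) = X := by
  have hinj : Function.Injective (X : Rpq p q →ₗ[ℝ] Rpq p q) := by
    rw [← LinearMap.ker_eq_bot, LinearMap.ker_eq_bot']
    intro a ha
    refine eq_zero_of_eta_eq_zero fun b => ?_
    rw [← hX, show X a = 0 from ha]
    simp [eta]
  let e := (LinearEquiv.ofInjectiveEndo _ hinj).toContinuousLinearEquiv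
  exact ⟨⟨ContinuousLinearEquiv.toUnit e, hX⟩, rfl⟩

variable {E : Type*} [NormedAddCommGroup E] [NormedSpace ℝ E]

/-- The derivative of `eta (κ a) (κ b)` vanishes because `Ω` is `𝔬(p,q)`-valued, so this function
keeps its value at the centre of the ball. -/
lemma eta_solution {Ω : E → E →L[ℝ] EndR p q} {y₀ : E} {r : ℝ} (hr : 0 < r)
    (hΩ : ∀ y ∈ ball y₀ r, ∀ v, Ω y v ∈ lorentzAlg p q) {κ : E → EndR p q} (hκ0 : κ y₀ = 1)
    (hκ : ∀ y ∈ ball y₀ r,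
      HasFDerivAt κ ((ContinuousLinearMap.mul ℝ (EndR p q)).flip (κ y) ∘L Ω y) y)
    {y : E} (hy : y ∈ ball y₀ r) (a b : Rpq p q) : eta (κ y a) (κ y b) = eta a b := by
  have hd : ∀ y ∈ ball y₀ r,
      HasFDerivAt (fun y => etaL p q (κ y a) (κ y b)) (0 : E →L[ℝ] ℝ) y := fun y hy => by
    have h1 : ∀ a, HasFDerivAt (fun y => κ y a) _ y := fun a =>
      (hκ y hy).clm_apply (hasFDerivAt_const a y)
    have h2 := ((etaL p q).hasFDerivAt.comp y (h1 a)).clm_apply (h1 b)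
    refine h2.congr_fderiv (ContinuousLinearMap.ext fun v => ?_)
    have h3 : eta (Ω y v (κ y a)) (κ y b) + eta (κ y a) (Ω y v (κ y b)) = 0 :=
      hΩ y hy v (κ y a) (κ y b)
    rw [add_comm] at h3
    simpa [etaL_apply] using h3
  have h := isOpen_ball.is_const_of_fderiv_eq_zero (𝕜 := ℝ) (convex_ball y₀ r).isPreconnected
    (fun z hz => (hd z hz).differentiableAt.differentiableWithinAt) (fun z hz => (hd z hz).fderiv)
    hy (mem_ball_self hr)
  simpa [hκ0, etaL_apply] using h

/-- Local existence of `O(p,q)`-valued solutions of a flat `𝔬(p,q)`-valued linear system. -/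
lemma exists_local_lorentz {l : E → E →L[ℝ] EndR p q} {U : Set E} (hU : IsOpen U) {y₀ : E}
    (hy₀ : y₀ ∈ U) (hl : ContDiffOn ℝ ∞ l U) (hmem : ∀ y v, l y v ∈ lorentzAlg p q)
    (hflat : ∀ y ∈ U, ∀ v w, fderiv ℝ l y v w - fderiv ℝ l y w v
      + (l y v * l y w - l y w * l y v) = 0) :
    ∃ r > 0, ∃ k : E → lorentz p q, ∀ y ∈ ball y₀ r,
      HasFDerivAt (fun y => ((k y : (EndR p q)ˣ) : EndR p q))
        ((ContinuousLinearMap.mul ℝ (EndR p q)).flip (k y : (EndR p q)ˣ) ∘L (-l y)) y := by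
  obtain ⟨r, hr, κ, hκ0, hκ⟩ := exists_local_solution_neg hU hy₀ hl hflat
  have hη : ∀ y ∈ ball y₀ r, ∀ a b, eta (κ y a) (κ y b) = eta a b := fun y hy a b =>
    eta_solution (Ω := fun y => -l y) (κ := κ) hr (fun y _ v => neg_mem (hmem y v)) hκ0 hκ hy a b
  have hκη : ∀ y ∈ ball y₀ r, ∃ h : lorentz p q, ((h : (EndR p q)ˣ) : EndR p q) = κ y :=
    fun y hy => exists_lorentz_eq (hη y hy)
  -- Outside the ball `k` is arbitrary; the ball is open, so derivatives inside it do not see those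
  -- values.
  choose! k hk using hκη
  refine ⟨r, hr, k, fun y hy => ?_⟩
  rw [hk y hy]
  refine (hκ y hy).congr_of_eventuallyEq ?_
  filter_upwards [isOpen_ball.mem_nhds hy] with z hz
  exact hk z hz

variable {M : Type*} [TopologicalSpace M] [ChartedSpace E M]

lemma localOne_mem {A : OneForm E M (EndR p q)}
    (hAmem : ∀ (x : M) (v : TangentSpace 𝓘(ℝ, E) x), A.toFun x v ∈ lorentzAlg p q)
    (φ : OpenPartialHomeomorph M E) (y v : E) : localOne φ A.toFun y v ∈ lorentzAlg p q :=
  hAmem (φ.symm y) (mfderiv 𝓘(ℝ, E) 𝓘(ℝ, E) φ.symm y v)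

variable [IsManifold 𝓘(ℝ, E) ∞ M]

/-- Local existence of parallel `O(p,q)`-valued functions for a flat connection. -/
lemma exists_local_parallel {A : OneForm E M (EndR p q)}
    (hAmem : ∀ (x : M) (v : TangentSpace 𝓘(ℝ, E) x), A.toFun x v ∈ lorentzAlg p q)
    (hA : ∀ (x : M) (v w : TangentSpace 𝓘(ℝ, E) x),
      extDer A x v w + (A.toFun x v * A.toFun x w - A.toFun x w * A.toFun x v) = 0) (x₀ : M) :
    ∃ U : Set M, IsOpen U ∧ x₀ ∈ U ∧ ∃ κ : M → lorentz p q, ∀ x ∈ U,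
      IsParallelAt A (fun y => (κ y : (EndR p q)ˣ)) x := by
  have : IsManifold 𝓘(ℝ, E) 1 M := .of_le (n := ∞) (by simp)
  set φ := chartAt E x₀
  have hφ : φ ∈ atlas E M := chart_mem_atlas E x₀
  have hx₀ : x₀ ∈ φ.source := mem_chart_source E x₀
  obtain ⟨r, hr, k, hk⟩ := exists_local_lorentz φ.open_target (φ.map_source hx₀) (A.smooth φ hφ)
    (localOne_mem hAmem φ) fun y hy v w => flat_localOne hA hφ hy v w
  exact ⟨_, φ.isOpen_inter_preimage isOpen_ball, ⟨hx₀, mem_ball_self hr⟩, fun x => k (φ x),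
    fun x hx => isParallelAt_of_chart hφ hx.1 (hk _ hx.2) Filter.EventuallyEq.rfl⟩

/-- A flat `𝔬(p,q)`-connection over a manifold with trivial fundamental groups has a global parallel
`O(p,q)`-valued function. -/
theorem exists_parallel [LocallyPathConnectedSpace M]
    (hM : ∀ x : M, Subsingleton (FundamentalGroup M x)) {A : OneForm E M (EndR p q)}
    (hAmem : ∀ (x : M) (v : TangentSpace 𝓘(ℝ, E) x), A.toFun x v ∈ lorentzAlg p q)
    (hA : ∀ (x : M) (v w : TangentSpace 𝓘(ℝ, E) x),
      extDer A x v w + (A.toFun x v * A.toFun x w - A.toFun x w * A.toFun x v) = 0) :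
    ∃ k : M → lorentz p q, ∀ x, IsParallelAt A (fun y => (k y : (EndR p q)ˣ)) x := by
  have : IsManifold 𝓘(ℝ, E) 1 M := .of_le (n := ∞) (by simp)
  choose U hU hmem κ hκ using exists_local_parallel hAmem hA
  obtain ⟨s, hs⟩ := exists_locally_constant_correction hM U hU hmem κ fun i j x hx => by
    have h : ∀ᶠ y in 𝓝 x, HasMFDerivAt 𝓘(ℝ, E) 𝓘(ℝ, EndR p q)
        (fun y => (((κ j y : (EndR p q)ˣ)⁻¹ * (κ i y : (EndR p q)ˣ) : (EndR p q)ˣ) : EndR p q)) y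
        (0 : E →L[ℝ] EndR p q) := by
      filter_upwards [((hU i).inter (hU j)).mem_nhds hx] with y hy
      exact (hκ i y hy.1).inv_mul (hκ j y hy.2)
    filter_upwards [eventually_eq_of_hasMFDerivAt_zero h] with y hy
    exact Subtype.ext (Units.ext hy)
  -- Near `x`, `s` is the local solution `κ x` times the constant `(κ x x)⁻¹ * s x`.
  refine ⟨s, fun x => ((hκ x x (hmem x)).mul_const
    (((κ x x)⁻¹ * s x : lorentz p q) : (EndR p q)ˣ)).congr ?_⟩
  filter_upwards [hs x x (hmem x)] with y hy
  rw [← hy]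
  simp

end Lorentz

/-! ### Smoothness of `h` and the 1-form `e' - h e`. -/

section GaugeForm

open Set Topology

variable {E : Type*} [NormedAddCommGroup E] [NormedSpace ℝ E]
  {M : Type*} [TopologicalSpace M] [ChartedSpace E M]
  {𝒜 : Type*} [NormedRing 𝒜] [NormedAlgebra ℝ 𝒜]
  {V : Type*} [NormedAddCommGroup V] [NormedSpace ℝ V]

/-- Smoothness in charts of a solution of `dh = h A - A' h`. -/
lemma contDiffOn_of_intertwining [IsManifold 𝓘(ℝ, E) ∞ M] {A A' : OneForm E M 𝒜} {h : M → 𝒜}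
    (hh : ∀ x, HasMFDerivAt 𝓘(ℝ, E) 𝓘(ℝ, 𝒜) h x
      (ContinuousLinearMap.mul ℝ 𝒜 (h x) ∘L (A.toFun x : E →L[ℝ] 𝒜)
        - (ContinuousLinearMap.mul ℝ 𝒜).flip (h x) ∘L (A'.toFun x : E →L[ℝ] 𝒜)))
    {φ : OpenPartialHomeomorph M E} (hφ : φ ∈ atlas E M) :
    ContDiffOn ℝ ∞ (h ∘ φ.symm) φ.target := by
  have : IsManifold 𝓘(ℝ, E) 1 M := .of_le (n := ∞) (by simp)
  refine contDiffOn_of_hasFDerivAt_eq (G := fun z =>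
    ContinuousLinearMap.mul ℝ 𝒜 z.2 ∘L localOne φ A.toFun z.1
      - (ContinuousLinearMap.mul ℝ 𝒜).flip z.2 ∘L localOne φ A'.toFun z.1) φ.open_target ?_ ?_
  · have h1 : ∀ A : OneForm E M 𝒜, ContDiffOn ℝ ∞ (fun z : E × 𝒜 => localOne φ A.toFun z.1)
        (φ.target ×ˢ univ) := fun A =>
      (A.smooth φ hφ).comp contDiff_fst.contDiffOn fun z hz => hz.1
    have h2 : ∀ L : 𝒜 →L[ℝ] 𝒜 →L[ℝ] 𝒜, ContDiffOn ℝ ∞ (fun z : E × 𝒜 => L z.2)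
        (φ.target ×ˢ univ) := fun L => (L.contDiff.comp contDiff_snd).contDiffOn
    exact ((h2 _).clm_comp (h1 A)).sub ((h2 _).clm_comp (h1 A'))
  · intro y hy
    exact HasMFDerivAt.comp_chart_symm hφ hy (hh (φ.symm y))

/-- The 1-form `e' - h e`. -/
def OneForm.subAct (e' e : OneForm E M V) (h : M → V →L[ℝ] V)
    (hh : ∀ φ ∈ atlas E M, ContDiffOn ℝ ∞ (h ∘ φ.symm) φ.target) : OneForm E M V where
  toFun x := e'.toFun x - h x ∘L e.toFun x
  smooth φ hφ := by
    have h1 : localOne φ (fun x => e'.toFun x - h x ∘L e.toFun x)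
        = fun y => localOne φ e'.toFun y - (h ∘ φ.symm) y ∘L localOne φ e.toFun y := rfl
    rw [h1]
    exact (e'.smooth φ hφ).sub ((hh φ hφ).clm_comp (e.smooth φ hφ))

/-- The Leibniz rule `d(e' - h e) = de' - dh ∧ e - h de`, with `L` in the role of `dh`. -/
lemma extDer_subAct [IsManifold 𝓘(ℝ, E) ∞ M] (e' e : OneForm E M V) {h : M → V →L[ℝ] V}
    (hh : ∀ φ ∈ atlas E M, ContDiffOn ℝ ∞ (h ∘ φ.symm) φ.target) {x : M}
    {L : E →L[ℝ] V →L[ℝ] V} (hL : HasMFDerivAt 𝓘(ℝ, E) 𝓘(ℝ, V →L[ℝ] V) h x L)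
    (v w : TangentSpace 𝓘(ℝ, E) x) :
    extDer (e'.subAct e h hh) x v w = extDer e' x v w
      - (L v (e.toFun x w) - L w (e.toFun x v) + h x (extDer e x v w)) := by
  have : IsManifold 𝓘(ℝ, E) 1 M := .of_le (n := ∞) (by simp)
  set φ := chartAt E x
  have hφ : φ ∈ atlas E M := chart_mem_atlas E x
  have hx : x ∈ φ.source := mem_chart_source E x
  have hd : ∀ e : OneForm E M V, HasFDerivAt (localOne φ e.toFun)
      (fderiv ℝ (localOne φ e.toFun) (φ x)) (φ x) := fun e =>
    (((e.smooth φ hφ).contDiffAt (φ.open_target.mem_nhds (φ.map_source hx))).differentiableAt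
      (by simp)).hasFDerivAt
  have hL' : HasMFDerivAt 𝓘(ℝ, E) 𝓘(ℝ, V →L[ℝ] V) h (φ.symm (φ x)) L := by
    rw [φ.left_inv hx]; exact hL
  have hhd := HasMFDerivAt.comp_chart_symm hφ (φ.map_source hx) hL'
  have hda : HasFDerivAt (localOne φ (e'.subAct e h hh).toFun) _ (φ x) :=
    (hd e').sub (hhd.clm_comp (hd e))
  rw [extDer_eq _ hφ hx, extDer_eq _ hφ hx, extDer_eq _ hφ hx, hda.fderiv]
  have hsymm : ∀ v : TangentSpace 𝓘(ℝ, E) x,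
      mfderiv 𝓘(ℝ, E) 𝓘(ℝ, E) φ.symm (φ x) (mfderiv 𝓘(ℝ, E) 𝓘(ℝ, E) φ x v) = v := fun v =>
    congrArg (fun L : E →L[ℝ] E => L v)
      ((mdifferentiable_of_mem_atlas (I := 𝓘(ℝ, E)) hφ).symm_comp_deriv hx)
  have hv := hsymm v
  have hw := hsymm w
  have hev := localOne_apply_mfderiv e.toFun hφ hx v
  have hew := localOne_apply_mfderiv e.toFun hφ hx w
  have hhx : h (φ.symm (φ x)) = h x := by rw [φ.left_inv hx]
  generalize hv' : (mfderiv 𝓘(ℝ, E) 𝓘(ℝ, E) φ x v : E) = v' at *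
  generalize hw' : (mfderiv 𝓘(ℝ, E) 𝓘(ℝ, E) φ x w : E) = w' at *
  change (fderiv ℝ (localOne φ e'.toFun) (φ x) v' w'
      - (h (φ.symm (φ x)) (fderiv ℝ (localOne φ e.toFun) (φ x) v' w')
        + L (mfderiv 𝓘(ℝ, E) 𝓘(ℝ, E) φ.symm (φ x) v') (localOne φ e.toFun (φ x) w')))
    - (fderiv ℝ (localOne φ e'.toFun) (φ x) w' v'
      - (h (φ.symm (φ x)) (fderiv ℝ (localOne φ e.toFun) (φ x) w' v')
        + L (mfderiv 𝓘(ℝ, E) 𝓘(ℝ, E) φ.symm (φ x) w') (localOne φ e.toFun (φ x) v'))) = _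
  rw [hhx, hev, hew, map_sub]
  have hv2 : L (mfderiv 𝓘(ℝ, E) 𝓘(ℝ, E) φ.symm (φ x) v') = L v := congrArg L hv
  have hw2 : L (mfderiv 𝓘(ℝ, E) 𝓘(ℝ, E) φ.symm (φ x) w') = L w := congrArg L hw
  rw [hv2, hw2]
  abel

end GaugeForm

/-! ### Linear and translation parts of fake flatness. -/

section Tel

variable {p q : ℕ}

/-- `linPart` as a continuous linear map. -/
def linPartL (p q : ℕ) : EndAff p q →L[ℝ] EndR p q :=
  LinearMap.toContinuousLinearMap
    { toFun := linPart, map_add' := fun _ _ => rfl, map_smul' := fun _ _ => rfl }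

/-- `transPart` as a continuous linear map. -/
def transPartL (p q : ℕ) : EndAff p q →L[ℝ] Rpq p q :=
  LinearMap.toContinuousLinearMap
    { toFun := transPart, map_add' := fun _ _ => rfl, map_smul' := fun _ _ => rfl }

/-- The embedding `ξ ↦ (ξ, 0)` as a continuous linear map. -/
def affBlockL (p q : ℕ) : EndR p q →L[ℝ] EndAff p q :=
  LinearMap.toContinuousLinearMap
    { toFun := fun ξ => affBlock ξ 0 0
      map_add' := fun ξ ξ' => ContinuousLinearMap.ext fun z => by simp
      map_smul' := fun r ξ => ContinuousLinearMap.ext fun z => by simp }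

lemma affBlock_add (ξ ξ' : EndR p q) (u u' : Rpq p q) (c c' : ℝ) :
    affBlock ξ u c + affBlock ξ' u' c' = affBlock (ξ + ξ') (u + u') (c + c') :=
  ContinuousLinearMap.ext fun z => by
    ext <;> simp [add_mul]; ring

lemma affBlock_sub (ξ ξ' : EndR p q) (u u' : Rpq p q) (c c' : ℝ) :
    affBlock ξ u c - affBlock ξ' u' c' = affBlock (ξ - ξ') (u - u') (c - c') :=
  ContinuousLinearMap.ext fun z => by
    ext <;> simp [sub_mul]; ring

lemma eq_affBlock {X : EndAff p q} (hX : X ∈ poincareAlg p q) :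
    X = affBlock (linPart X) (transPart X) 0 := by
  obtain ⟨ξ, -, u, rfl⟩ := hX
  simp

lemma linPart_mem {X : EndAff p q} (hX : X ∈ poincareAlg p q) : linPart X ∈ lorentzAlg p q := by
  obtain ⟨ξ, hξ, u, rfl⟩ := hX
  simpa using hξ

lemma lie_eq_affBlock {X Y : EndAff p q} (hX : X ∈ poincareAlg p q) (hY : Y ∈ poincareAlg p q) :
    X * Y - Y * X = affBlock (linPart X * linPart Y - linPart Y * linPart X)
      (linPart X (transPart Y) - linPart Y (transPart X)) 0 := by
  conv_lhs => rw [eq_affBlock hX, eq_affBlock hY, affBlock_mul, affBlock_mul, affBlock_sub]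
  simp

variable {E : Type*} [NormedAddCommGroup E] [NormedSpace ℝ E]
  {M : Type*} [TopologicalSpace M] [ChartedSpace E M] [IsManifold 𝓘(ℝ, E) ∞ M]

/-- The image of `dt` has no linear part, so fake flatness forces `ω` to be flat. -/
lemma extDer_lin (c : TwoConnection E M (Tel p q)) (x : M) (v w : TangentSpace 𝓘(ℝ, E) x) :
    extDer (c.A.postcomp (linPartL p q)) x v w
      + (c.ω x v * c.ω x w - c.ω x w * c.ω x v) = 0 := by
  have h := congrArg (linPartL p q) (c.fakeFlat x v w)
  rw [map_add, ← extDer_postcomp, lie_eq_affBlock (c.A_mem x v) (c.A_mem x w)] at h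
  refine Eq.trans ?_ (h.trans (linPart_affBlock 0 (c.B.toFun x v w) 0))
  exact congrArg (_ + ·) (linPart_affBlock _ _ _).symm

/-- The translation part of fake flatness is `B = d_ω e`: the 2-form carries no independent data. -/
lemma extDer_trans (c : TwoConnection E M (Tel p q)) (x : M) (v w : TangentSpace 𝓘(ℝ, E) x) :
    extDer (c.A.postcomp (transPartL p q)) x v w
      + (c.ω x v (c.e x w) - c.ω x w (c.e x v)) = c.B.toFun x v w := by
  have h := congrArg (transPartL p q) (c.fakeFlat x v w)
  rw [map_add, ← extDer_postcomp, lie_eq_affBlock (c.A_mem x v) (c.A_mem x w)] at h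
  refine Eq.trans ?_ (h.trans (transPart_affBlock 0 (c.B.toFun x v w) 0))
  exact congrArg (_ + ·) (transPart_affBlock _ _ 0).symm

end Tel

/-! ### The transformation law for `Tel(p,q)` 2-connections. -/

section TelGauge

variable {p q : ℕ} {E : Type*} [NormedAddCommGroup E] [NormedSpace ℝ E]
  {M : Type*} [TopologicalSpace M] [ChartedSpace E M]

lemma affBlock_mul_affBlock_zero (ξ ξ' : EndR p q) :
    affBlock ξ 0 1 * affBlock ξ' 0 0 = affBlock (ξ * ξ') 0 0 := by
  rw [affBlock_mul]
  simp

/-- The algebra behind the transformation law of the 2-form of a 2-connection. -/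
lemma curvature_identity {V : Type*} [NormedAddCommGroup V] [NormedSpace ℝ V]
    {h X Y X' Y' : V →L[ℝ] V} {x y x' y' d d' b b' D : V} (hb : d + (X y - Y x) = b)
    (hb' : d' + (X' y' - Y' x') = b')
    (hD : D = d' - ((h (X y) - X' (h y)) - (h (Y x) - Y' (h x)) + h d)) :
    b' = h b + (D + (X' (y' - h y) - Y' (x' - h x))) := by
  -- With `dh = h ω - ω' h` inserted, the terms in `ω' ∧ h e` cancel, and `h (de + ω ∧ e)`
  -- reassembles `h B`.
  rw [hD, ← hb, ← hb']
  simp only [map_add, map_sub]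
  abel

/-- A gauge transformation of the `𝔬(p,q)`-part extends to a weak `Poinc(p,q)` gauge
transformation of `Tel(p,q)` 2-connections. -/
lemma transforms_of_lin {c c' : TwoConnection E M (Tel p q)} (γ : WeakGauge E M (Poinc p q))
    (hω : ∀ (x : M) (v : TangentSpace 𝓘(ℝ, E) x),
      c'.ω x v = ((γ.g x : (EndR p q)ˣ) : EndR p q) * c.ω x v
        * (((γ.g x)⁻¹ : (EndR p q)ˣ) : EndR p q) + gdgInv (fun y => (γ.g y : (EndR p q)ˣ)) x v)
    (he : ∀ (x : M) (v : TangentSpace 𝓘(ℝ, E) x),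
      c'.e x v = ((γ.g x : (EndR p q)ˣ) : EndR p q) (c.e x v) + γ.a.toFun x v)
    (hd : ∀ x, MDifferentiableAt 𝓘(ℝ, E) 𝓘(ℝ, EndR p q)
      (fun y => (((γ.g y)⁻¹ : (EndR p q)ˣ) : EndR p q)) x)
    (hB : ∀ (x : M) (v w : TangentSpace 𝓘(ℝ, E) x),
      c'.B.toFun x v w = ((γ.g x : (EndR p q)ˣ) : EndR p q) (c.B.toFun x v w)
        + (extDer γ.a x v w + (c'.ω x v (γ.a.toFun x w) - c'.ω x w (γ.a.toFun x v)))) :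
    γ.toTel.Transforms c c' := by
  refine ⟨fun x v => ?_, fun x v w => ?_⟩
  · have hmf : HasMFDerivAt 𝓘(ℝ, E) 𝓘(ℝ, EndAff p q)
        (fun y => (((affUnit (γ.g y : (EndR p q)ˣ) 0)⁻¹ : (EndAff p q)ˣ) : EndAff p q)) x
        (affBlockL p q ∘L (mfderiv 𝓘(ℝ, E) 𝓘(ℝ, EndR p q)
          (fun y => (((γ.g y)⁻¹ : (EndR p q)ˣ) : EndR p q)) x : E →L[ℝ] EndR p q)) := by
      -- The inverse of `(h, 0)` is affine in `h⁻¹`; the constant corner entry `1` disappears on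
      -- differentiation.
      have h1 : HasFDerivAt (fun ξ => affBlockL p q ξ + affBlock 0 0 1) (affBlockL p q)
          (((γ.g x)⁻¹ : (EndR p q)ˣ) : EndR p q) :=
        (affBlockL p q).hasFDerivAt.add_const _
      have h2 := HasMFDerivAt.comp x (I' := 𝓘(ℝ, EndR p q)) h1.hasMFDerivAt (hd x).hasMFDerivAt
      refine h2.congr_of_eventuallyEq (Filter.Eventually.of_forall fun y => ?_)
      change (((affUnit (γ.g y : (EndR p q)ˣ) 0)⁻¹ : (EndAff p q)ˣ) : EndAff p q)
        = affBlockL p q (((γ.g y)⁻¹ : (EndR p q)ˣ) : EndR p q) + affBlock 0 0 1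
      rw [affUnit_inv]
      refine ContinuousLinearMap.ext fun z => ?_
      ext <;> simp [affUnit, affBlockL]
    have hg : gdgInv (fun y => (γ.toTel.g y : (EndAff p q)ˣ)) x v
        = affBlock (gdgInv (fun y => (γ.g y : (EndR p q)ˣ)) x v) 0 0 := by
      have h3 : gdgInv (fun y => (γ.toTel.g y : (EndAff p q)ˣ)) x v
          = affBlock (γ.g x : (EndR p q)ˣ) 0 1 * affBlock (mfderiv 𝓘(ℝ, E) 𝓘(ℝ, EndR p q)
          (fun y => (((γ.g y)⁻¹ : (EndR p q)ˣ) : EndR p q)) x v) 0 0 :=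
        congrArg (fun L : E →L[ℝ] EndAff p q =>
          affBlock ((γ.g x : (EndR p q)ˣ) : EndR p q) 0 1 * L v) hmf.mfderiv
      exact h3.trans (affBlock_mul_affBlock_zero _ _)
    have h4 : (((γ.toTel.g x)⁻¹ : (EndAff p q)ˣ) : EndAff p q)
        = affBlock (((γ.g x)⁻¹ : (EndR p q)ˣ) : EndR p q) 0 1 := by
      change (((affUnit (γ.g x : (EndR p q)ˣ) 0)⁻¹ : (EndAff p q)ˣ) : EndAff p q) = _
      rw [affUnit_inv]
      simp [affUnit]
    have h5 : ((Tel p q).dt (γ.toTel.a.toFun x v) : EndAff p q)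
        = affBlock 0 (γ.a.toFun x v) 0 := rfl
    have h6 : ((γ.toTel.g x : (EndAff p q)ˣ) : EndAff p q)
        = affBlock (γ.g x : (EndR p q)ˣ) 0 1 := rfl
    rw [hg, h4, h5, h6, eq_affBlock (c'.A_mem x v), eq_affBlock (c.A_mem x v), affBlock_mul,
      affBlock_mul, affBlock_add, affBlock_add]
    change affBlock (c'.ω x v) (c'.e x v) 0 = _
    rw [hω, he]
    simp
    rfl
  · refine (hB x v w).trans ?_
    have h1 : (Tel p q).α (γ.toTel.g x) = ((γ.g x : (EndR p q)ˣ) : EndR p q) :=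
      linPart_affBlock _ _ _
    rw [h1]
    rfl

end TelGauge
end HigherGauge

end

/-! ### The main theorem. -/

theorem mainTheorem6 (p q : ℕ)
    {E : Type*} [NormedAddCommGroup E] [NormedSpace ℝ E] [FiniteDimensional ℝ E]
    {M : Type*} [TopologicalSpace M] [T2Space M] [SecondCountableTopology M]
    [ChartedSpace E M] [IsManifold 𝓘(ℝ, E) ∞ M]
    (hM : ∀ x : M, Subsingleton (FundamentalGroup M x))
    (c c' : HigherGauge.TwoConnection E M (HigherGauge.Tel p q)) :
    ∃ γ : HigherGauge.WeakGauge E M (HigherGauge.Poinc p q),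
      γ.toTel.Transforms c c' ∧
      (∀ (x : M) (v : TangentSpace 𝓘(ℝ, E) x),
        c'.ω x v =
          ((γ.g x : (HigherGauge.EndR p q)ˣ) : HigherGauge.EndR p q) * c.ω x v
              * (((γ.g x)⁻¹ : (HigherGauge.EndR p q)ˣ) : HigherGauge.EndR p q)
            + HigherGauge.gdgInv (fun y => (γ.g y : (HigherGauge.EndR p q)ˣ)) x v) ∧
      (∀ (x : M) (v : TangentSpace 𝓘(ℝ, E) x),
        c'.e x v =
          ((γ.g x : (HigherGauge.EndR p q)ˣ) : HigherGauge.EndR p q) (c.e x v)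
            + γ.a.toFun x v) := by
  open HigherGauge in
  have : LocallyPathConnectedSpace M := ChartedSpace.locallyPathConnectedSpace E M
  obtain ⟨k, hk⟩ := exists_parallel hM (A := c.A.postcomp (linPartL p q))
    (fun x v => linPart_mem (c.A_mem x v)) (extDer_lin c)
  obtain ⟨k', hk'⟩ := exists_parallel hM (A := c'.A.postcomp (linPartL p q))
    (fun x v => linPart_mem (c'.A_mem x v)) (extDer_lin c')
  have hd := fun x => (hk x).mul_inv (hk' x)
  -- With the roles exchanged, the same lemma differentiates `h⁻¹ = k k'⁻¹`, giving `d(h⁻¹) = h⁻¹ ω'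
  -- - ω h⁻¹` and hence `h d(h⁻¹) = ω' - h ω h⁻¹`.
  have hd' := fun x => (hk' x).mul_inv (hk x)
  have hch := fun φ hφ => contDiffOn_of_intertwining hd (φ := φ) hφ
  let e := c.A.postcomp (transPartL p q)
  let e' := c'.A.postcomp (transPartL p q)
  let γ : WeakGauge E M (Poinc p q) :=
    { g := fun x => k' x * (k x)⁻¹
      smooth_g := contMDiff_of_contDiffOn_charts hch
      a := e'.subAct e _ hch }
  have hinv : (fun y => (((γ.g y)⁻¹ : (EndR p q)ˣ) : EndR p q))
      = fun y => (((k y : (EndR p q)ˣ) * (k' y : (EndR p q)ˣ)⁻¹ : (EndR p q)ˣ) : EndR p q) := by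
    funext y
    change ((((k' y : (EndR p q)ˣ) * (k y : (EndR p q)ˣ)⁻¹)⁻¹ : (EndR p q)ˣ) : EndR p q) = _
    rw [mul_inv_rev, inv_inv]
  have hω : ∀ (x : M) (v : TangentSpace 𝓘(ℝ, E) x),
      c'.ω x v = ((γ.g x : (EndR p q)ˣ) : EndR p q) * c.ω x v
        * (((γ.g x)⁻¹ : (EndR p q)ˣ) : EndR p q)
        + gdgInv (fun y => (γ.g y : (EndR p q)ˣ)) x v := fun x v => by
    have h1 := ((hd' x).congr_of_eventuallyEq (Filter.EventuallyEq.of_eq hinv)).mfderiv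
    have h2 : gdgInv (fun y => (γ.g y : (EndR p q)ˣ)) x v
        = ((γ.g x : (EndR p q)ˣ) : EndR p q) * ((((γ.g x)⁻¹ : (EndR p q)ˣ) : EndR p q) * c'.ω x v
          - c.ω x v * (((γ.g x)⁻¹ : (EndR p q)ˣ) : EndR p q)) := by
      rw [congrFun hinv x]
      exact congrArg (fun L : E →L[ℝ] EndR p q => ((γ.g x : (EndR p q)ˣ) : EndR p q) * L v) h1
    rw [h2, mul_sub, Units.mul_inv_cancel_left, mul_assoc]
    abel
  have he : ∀ (x : M) (v : TangentSpace 𝓘(ℝ, E) x),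
      c'.e x v = ((γ.g x : (EndR p q)ˣ) : EndR p q) (c.e x v) + γ.a.toFun x v := fun x v =>
    (add_sub_cancel _ _).symm
  refine ⟨γ, transforms_of_lin γ hω he (fun x => ?_) (fun x v w => ?_), hω, he⟩
  · rw [hinv]
    exact (hd' x).mdifferentiableAt
  · have h1 := extDer_subAct e' e hch (hd x) v w
    have h2 := extDer_trans c x v w
    have h3 := extDer_trans c' x v w
    exact curvature_identity h2 h3 h1
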